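/- **Conventions on Lie 2-algebras.** A *Lie 2-algebra* is a 2-term complex of vector spaces $L_0\xleftarrow{d}L_1$ with a bracket, i.e. a chain map $[\cdot,\cdot]\colon L\otimes L\to L$; an *alternator* $S\colon L_0\otimes L_0\to L_1$, a chain homotopy from $[x,y]$ to $-[y,x]$; and an antisymmetric *Jacobiator* $J\colon L_0^{\otimes 3}\to L_1$, a chain homotopy from $[x,[y,z]]$ to $[[x,y],z]+[y,[x,z]]$ (a chain homotopy $T\colon f\Rightarrow g$ satisfies $f+dT+Td=g$), such that for all $w,x,y,z\in L_0$ $$[w,J_{x,y,z}]+J_{w,[x,y],z}+J_{w,y,[x,z]}+[y,J_{w,x,z}]+[J_{w,x,y},z]=J_{w,x,[y,z]}+J_{[w,x],y,z}+[x,J_{w,y,z}]+J_{x,[w,y],z}+J_{x,y,[w,z]},$$ $$[S_{x,y},z]+J_{y,x,z}=-J_{x,y,z},\qquad [x,S_{y,z}]-J_{x,z,y}=J_{x,y,z}+S_{[x,y],z}+S_{y,[x,z]},\qquad S_{x,[y,z]}=S_{[y,z],x}.$$ It is *hemistrict* if $J=0$ and *semistrict* if $S=0$. A *homomorphism* $L\to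 L'$ is a chain map $\phi$ with a chain homotopy $\Phi\colon L_0\otimes L_0\to L_1'$ from $[\phi(x),\phi(y)]'$ to $\phi([x,y])$ such that $$\Phi_{x,y}+\phi(S_{x,y})=S'_{\phi(x),\phi(y)}-\Phi_{y,x},$$ $$J'_{\phi(x),\phi(y),\phi(z)}+[\Phi_{x,y},\phi(z)]'+[\phi(y),\Phi_{x,z}]'+\Phi_{[x,y],z}+\Phi_{y,[x,z]}=[\phi(x),\Phi_{y,z}]'+\Phi_{x,[y,z]}+\phi(J_{x,y,z}).$$ The composite of $(\phi,\Phi)\colon L\to L'$ and $(\psi,\Psi)\colon L'\to L''$ is $\psi\phi$ with the homotopy $\Psi_{\phi(x),\phi(y)}+\psi(\Phi_{x,y})$; the identity homomorphism is the identity chain map with zero homotopy. **Theorem.** Let $(X,\omega)$ be a 2-plectic manifold: a (finite-dimensional, Hausdorff) smooth manifold $X$ with a smooth closed 3-form $\omega$ that is nondegenerate, i.e. $\iota_v\omega=0$ implies $v=0$ for every tangent vector $v$. Let $\mathrm{Ham}(X)$ be the space of smooth 1-forms $F$ for which there is a smooth vector field $v_F$ (necessarily unique) with $dF=-\iota_{v_F}\omega$.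 Then on the complex $\mathrm{Ham}(X)\xleftarrow{d}C^\infty(X)$ the following data define a hemistrict Lie 2-algebra $L(X,\omega)_{\mathrm h}$ and a semistrict Lie 2-algebra $L(X,\omega)_{\mathrm s}$ (for $F,G,H\in\mathrm{Ham}(X)$, $f\in C^\infty(X)$): * $L(X,\omega)_{\mathrm h}$: $\{F,G\}=L_{v_F}G$, $\{F,f\}=L_{v_F}f$, $\{f,F\}=0$, $S_{F,G}=-(\iota_{v_F}G+\iota_{v_G}F)$, $J=0$; * $L(X,\omega)_{\mathrm s}$: $\{F,G\}=\iota_{v_G}\iota_{v_F}\omega$, $\{F,f\}=\{f,F\}=0$, $S=0$, $J_{F,G,H}=-\iota_{v_F}\iota_{v_G}\iota_{v_H}\omega$. These two Lie 2-algebras are isomorphic: there are homomorphisms $\phi\colon L(X,\omega)_{\mathrm h}\to L(X,\omega)_{\mathrm s}$ and $\psi\colon L(X,\omega)_{\mathrm s}\to L(X,\omega)_{\mathrm h}$ whose underlying chain maps are the identity, the chain homotopy of $\phi$ being $\Phi_{F,G}=\iota_{v_F}G$, such that $\psi\circ\phi$ and $\phi\circ\psi$ are the identity homomorphisms. -/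

import Mathlib

open scoped Manifold ContDiff

/-! ### Lie 2-algebras -/

/-- A (weak) Lie 2-algebra over `K` whose underlying 2-term complex is `L₀ ← L₁`.
Everything is written in components: the bracket `L ⊗ L → L` is given by its components
`br00`, `br01`, `br10` on `L₀ ⊗ L₀`, `L₀ ⊗ L₁`, `L₁ ⊗ L₀` (the component on `L₁ ⊗ L₁` lands in
`L₂ = 0`); a chain homotopy `T` from `f` to `g` satisfies `f + d T + T d = g`, and as `L₂ = 0`
the homotopies `S` and `J` are given by their components on 0-chains. -/
@[ext]
structure Lie2Algebra (K : Type*) [Field K] (L₀ L₁ : Type*) [AddCommGroup L₀] [Module K L₀]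
    [AddCommGroup L₁] [Module K L₁] where
  /-- the differential -/
  d : L₁ →ₗ[K] L₀
  /-- the bracket on `L₀ ⊗ L₀` -/
  br00 : L₀ →ₗ[K] L₀ →ₗ[K] L₀
  /-- the bracket on `L₀ ⊗ L₁` -/
  br01 : L₀ →ₗ[K] L₁ →ₗ[K] L₁
  /-- the bracket on `L₁ ⊗ L₀` -/
  br10 : L₁ →ₗ[K] L₀ →ₗ[K] L₁
  /-- the alternator -/
  S : L₀ →ₗ[K] L₀ →ₗ[K] L₁
  /-- the Jacobiator -/
  J : L₀ →ₗ[K] L₀ →ₗ[K] L₀ →ₗ[K] L₁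
  -- the bracket is a chain map (degree 1, then degree 2)
  d_br01 : ∀ x g, d (br01 x g) = br00 x (d g)
  d_br10 : ∀ f y, d (br10 f y) = br00 (d f) y
  br_d_d : ∀ f g, br10 f (d g) = br01 (d f) g
  -- the alternator is a chain homotopy from the bracket to minus the switched bracket
  S00 : ∀ x y, br00 x y + d (S x y) = -br00 y x
  S01 : ∀ x g, br01 x g + S x (d g) = -br10 g x
  S10 : ∀ f y, br10 f y + S (d f) y = -br01 y f
  -- the Jacobiator is a chain homotopy from `[x,[y,z]]` to `[[x,y],z] + [y,[x,z]]`
  J000 : ∀ x y z, br00 x (br00 y z) + d (J x y z) = br00 (br00 x y) z + br00 y (br00 x z)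
  J001 : ∀ x y h, br01 x (br01 y h) + J x y (d h) = br01 (br00 x y) h + br01 y (br01 x h)
  J010 : ∀ x g z, br01 x (br10 g z) + J x (d g) z = br10 (br01 x g) z + br10 g (br00 x z)
  J100 : ∀ f y z, br10 f (br00 y z) + J (d f) y z = br10 (br10 f y) z + br01 y (br10 f z)
  -- the Jacobiator is antisymmetric
  J_swap_left : ∀ x y z, J y x z = -J x y z
  J_swap_right : ∀ x y z, J x z y = -J x y z
  -- the four coherence diagrams
  coh_JJ : ∀ w x y z,
    br01 w (J x y z) + J w (br00 x y) z + J w y (br00 x z) + br01 y (J w x z)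
        + br10 (J w x y) z
      = J w x (br00 y z) + J (br00 w x) y z + br01 x (J w y z) + J x (br00 w y) z
        + J x y (br00 w z)
  coh_SJ_left : ∀ x y z, br10 (S x y) z + J y x z = -J x y z
  coh_SJ_right : ∀ x y z,
    br01 x (S y z) - J x z y = J x y z + (S (br00 x y) z + S y (br00 x z))
  coh_SS : ∀ x y z, S x (br00 y z) - S (br00 y z) x = 0

namespace Lie2Algebra

variable {K : Type*} [Field K]
  {L₀ L₁ M₀ M₁ N₀ N₁ : Type*}
  [AddCommGroup L₀] [Module K L₀] [AddCommGroup L₁] [Module K L₁]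
  [AddCommGroup M₀] [Module K M₀] [AddCommGroup M₁] [Module K M₁]
  [AddCommGroup N₀] [Module K N₀] [AddCommGroup N₁] [Module K N₁]

/-- The Jacobiator is the identity homotopy, i.e. its 1-chains vanish. -/
def IsHemistrict (L : Lie2Algebra K L₀ L₁) : Prop := ∀ x y z, L.J x y z = 0

/-- The alternator is the identity homotopy, i.e. its 1-chains vanish. -/
def IsSemistrict (L : Lie2Algebra K L₀ L₁) : Prop := ∀ x y, L.S x y = 0

/-- A homomorphism of Lie 2-algebras: a chain map `(f₀, f₁)` and a chain homotopy `Φ` from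
`[f -, f -]'` to `f [-, -]` making the two coherence diagrams commute. -/
@[ext]
structure Hom (L : Lie2Algebra K L₀ L₁) (M : Lie2Algebra K M₀ M₁) where
  /-- the chain map in degree 0 -/
  f₀ : L₀ →ₗ[K] M₀
  /-- the chain map in degree 1 -/
  f₁ : L₁ →ₗ[K] M₁
  /-- the chain homotopy -/
  Φ : L₀ →ₗ[K] L₀ →ₗ[K] M₁
  comm : ∀ g, M.d (f₁ g) = f₀ (L.d g)
  Φ00 : ∀ x y, M.br00 (f₀ x) (f₀ y) + M.d (Φ x y) = f₀ (L.br00 x y)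
  Φ01 : ∀ x g, M.br01 (f₀ x) (f₁ g) + Φ x (L.d g) = f₁ (L.br01 x g)
  Φ10 : ∀ g y, M.br10 (f₁ g) (f₀ y) + Φ (L.d g) y = f₁ (L.br10 g y)
  coh_S : ∀ x y, Φ x y + f₁ (L.S x y) = M.S (f₀ x) (f₀ y) - Φ y x
  coh_J : ∀ x y z,
    M.J (f₀ x) (f₀ y) (f₀ z) + (M.br10 (Φ x y) (f₀ z) + M.br01 (f₀ y) (Φ x z))
        + (Φ (L.br00 x y) z + Φ y (L.br00 x z))
      = M.br01 (f₀ x) (Φ y z) + Φ x (L.br00 y z) + f₁ (L.J x y z)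

/-- The identity homomorphism: the identity chain map with the identity homotopy. -/
def Hom.id (L : Lie2Algebra K L₀ L₁) : Hom L L where
  f₀ := LinearMap.id
  f₁ := LinearMap.id
  Φ := 0
  comm := by simp
  Φ00 := by simp
  Φ01 := by simp
  Φ10 := by simp
  coh_S := by simp
  coh_J := by simp

/-- The composite `g ∘ f`: the chain maps are composed, and the homotopy is the pasting
`[g f x, g f y]'' → g [f x, f y]' → g f [x, y]`. -/
def Hom.comp {L : Lie2Algebra K L₀ L₁} {M : Lie2Algebra K M₀ M₁} {N : Lie2Algebra K N₀ N₁}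
    (g : Hom M N) (f : Hom L M) : Hom L N where
  f₀ := g.f₀ ∘ₗ f.f₀
  f₁ := g.f₁ ∘ₗ f.f₁
  Φ := g.Φ.compl₁₂ f.f₀ f.f₀ + f.Φ.compr₂ g.f₁
  comm := by simp [f.comm, g.comm]
  Φ00 x y := by
    have h := g.Φ00 (f.f₀ x) (f.f₀ y)
    have h' := congrArg g.f₀ (f.Φ00 x y)
    simp only [map_add] at h'
    simp [g.comm, ← h', ← h, add_assoc]
  Φ01 x a := by
    have h := g.Φ01 (f.f₀ x) (f.f₁ a)
    have h' := congrArg g.f₁ (f.Φ01 x a)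
    simp only [map_add] at h'
    simp [← h', ← h, add_assoc, f.comm]
  Φ10 a y := by
    have h := g.Φ10 (f.f₁ a) (f.f₀ y)
    have h' := congrArg g.f₁ (f.Φ10 a y)
    simp only [map_add] at h'
    simp [← h', ← h, add_assoc, f.comm]
  coh_S x y := by
    have h := g.coh_S (f.f₀ x) (f.f₀ y)
    have h' := congrArg g.f₁ (f.coh_S x y)
    simp only [map_add, map_sub] at h'
    simp only [LinearMap.add_apply, LinearMap.compl₁₂_apply, LinearMap.compr₂_apply,
      LinearMap.comp_apply, add_assoc, h']
    rw [← add_sub_assoc, h]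
    abel
  coh_J x y z := by
    have h := g.coh_J (f.f₀ x) (f.f₀ y) (f.f₀ z)
    have h' := congrArg g.f₁ (f.coh_J x y z)
    have e₁ := g.Φ10 (f.Φ x y) (f.f₀ z)
    have e₂ := g.Φ01 (f.f₀ y) (f.Φ x z)
    have e₃ := g.Φ01 (f.f₀ x) (f.Φ y z)
    have k₁ := congrArg (fun t => g.Φ t (f.f₀ z)) (f.Φ00 x y)
    have k₂ := congrArg (fun t => g.Φ (f.f₀ y) t) (f.Φ00 x z)
    have k₃ := congrArg (fun t => g.Φ (f.f₀ x) t) (f.Φ00 y z)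
    simp only [map_add, LinearMap.add_apply] at h' k₁ k₂ k₃
    simp only [LinearMap.add_apply, LinearMap.compl₁₂_apply, LinearMap.compr₂_apply,
      LinearMap.comp_apply, map_add, ← k₁, ← k₂, ← k₃]
    rw [← e₁, ← e₂, ← e₃] at h'
    linear_combination (norm := module) h + h'

end Lie2Algebra

/-! ### Differential forms on a manifold -/

noncomputable section

namespace TwoPlectic

variable {E : Type*} [NormedAddCommGroup E] [NormedSpace ℝ E]
  {X : Type*} [TopologicalSpace X] [ChartedSpace E X]

variable (E X) in
/-- Not necessarily smooth `k`-forms on `X`. -/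
abbrev Form (k : ℕ) : Type _ := (x : X) → TangentSpace 𝓘(ℝ, E) x [⋀^Fin k]→L[ℝ] ℝ

variable (E X) in
/-- Smooth real-valued functions on `X`. -/
abbrev SmoothFun : Type _ := ContMDiffMap 𝓘(ℝ, E) 𝓘(ℝ, ℝ) X ℝ ∞

/-- The form `α` read in the chart at `x₀`, i.e. its pullback under the inverse of the chart. -/
def Form.inChart {k : ℕ} (α : Form E X k) (x₀ : X) : E → E [⋀^Fin k]→L[ℝ] ℝ := fun y =>
  (α ((extChartAt 𝓘(ℝ, E) x₀).symm y)).compContinuousLinearMap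
    (mfderiv 𝓘(ℝ, E) 𝓘(ℝ, E) (extChartAt 𝓘(ℝ, E) x₀).symm y)

/-- A form is smooth if its expression in every preferred chart is smooth. -/
def Form.IsSmooth {k : ℕ} (α : Form E X k) : Prop :=
  ∀ x₀ : X, ContDiffOn ℝ ∞ (α.inChart x₀) (extChartAt 𝓘(ℝ, E) x₀).target

/-- The exterior derivative of a form, computed at `x` in the chart at `x`. -/
def Form.extDeriv {k : ℕ} (α : Form E X k) : Form E X (k + 1) := fun x =>
  (_root_.extDeriv (α.inChart x) (extChartAt 𝓘(ℝ, E) x x)).compContinuousLinearMap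
    (mfderiv 𝓘(ℝ, E) 𝓘(ℝ, E) (extChartAt 𝓘(ℝ, E) x) x)

lemma inChart_add {k : ℕ} (α β : Form E X k) (x₀ : X) :
    (α + β).inChart x₀ = α.inChart x₀ + β.inChart x₀ := by
  ext y u; rfl

lemma inChart_smul {k : ℕ} (c : ℝ) (α : Form E X k) (x₀ : X) :
    (c • α).inChart x₀ = c • α.inChart x₀ := by
  ext y u; rfl

lemma Form.IsSmooth.differentiableAt {k : ℕ} {α : Form E X k} (h : α.IsSmooth) (x : X) :
    DifferentiableAt ℝ (α.inChart x) (extChartAt 𝓘(ℝ, E) x x) :=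
  ((h x).contDiffAt ((isOpen_extChartAt_target x).mem_nhds
    (mem_extChartAt_target x))).differentiableAt (by simp)

lemma extDeriv_add {k : ℕ} {α β : Form E X k} (hα : α.IsSmooth) (hβ : β.IsSmooth) :
    (α + β).extDeriv = α.extDeriv + β.extDeriv := by
  funext x
  simp only [Form.extDeriv, inChart_add, Pi.add_apply,
    _root_.extDeriv_add (hα.differentiableAt x) (hβ.differentiableAt x)]
  rfl

lemma extDeriv_smul {k : ℕ} (c : ℝ) (α : Form E X k) :
    (c • α).extDeriv = c • α.extDeriv := by
  funext x
  simp only [Form.extDeriv, inChart_smul, Pi.smul_apply, _root_.extDeriv_smul]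
  rfl

variable [IsManifold 𝓘(ℝ, E) ∞ X]

variable (E X) in
/-- Smooth vector fields on `X`. -/
abbrev VField : Type _ :=
  ContMDiffSection 𝓘(ℝ, E) E ∞ (TangentSpace 𝓘(ℝ, E) : X → Type _)

/-- The interior product `ι_v α = α(v, ·, …, ·)`. -/
def VField.interior {k : ℕ} (v : VField E X) (α : Form E X (k + 1)) : Form E X k := fun x =>
  ContinuousAlternatingMap.curryLeft (E := E) (α x) (v x)

/-- The value of a 0-form at a point. -/
def Form.value (α : Form E X 0) (x : X) : ℝ := α x ![]

/-- The differential of a function, as a 1-form. -/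
def differential (f : X → ℝ) : Form E X 1 := fun x =>
  ContinuousAlternatingMap.ofSubsingleton ℝ (TangentSpace 𝓘(ℝ, E) x) ℝ (0 : Fin 1)
    (mfderiv 𝓘(ℝ, E) 𝓘(ℝ, ℝ) f x)

/-- The Lie derivative `L_v f = df(v)` of a function. -/
def VField.lieDerivFun (v : VField E X) (f : X → ℝ) (x : X) : ℝ :=
  mfderiv 𝓘(ℝ, E) 𝓘(ℝ, ℝ) f x (v x)

/-- The vector field `v` read in the chart at `x₀`. -/
def VField.inChart (v : VField E X) (x₀ : X) : E → E :=
  VectorField.mpullback 𝓘(ℝ, E) 𝓘(ℝ, E) (extChartAt 𝓘(ℝ, E) x₀).symm v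

/-- The Lie derivative `L_v G` of a 1-form, computed at `x` in the chart at `x`, where its
components are `(L_v G)_i = ∑_j (v^j ∂_j G_i + G_j ∂_i v^j)`; this is the derivative at time `0` of
the pullback of `G` along the flow of `v`. -/
def VField.lieDeriv (v : VField E X) (G : Form E X 1) : Form E X 1 := fun x =>
  let p : E := extChartAt 𝓘(ℝ, E) x x
  (fderiv ℝ (G.inChart x) p (v.inChart x p)
      + (G.inChart x p).compContinuousLinearMap (fderiv ℝ (v.inChart x) p)).compContinuousLinearMap
    (mfderiv 𝓘(ℝ, E) 𝓘(ℝ, E) (extChartAt 𝓘(ℝ, E) x) x)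

/-- A 2-plectic structure: a smooth 3-form that is closed and nondegenerate. -/
structure IsTwoPlectic (Ω : Form E X 3) : Prop where
  smooth : Ω.IsSmooth
  closed : Ω.extDeriv = 0
  nondegenerate : ∀ (x : X) (v : TangentSpace 𝓘(ℝ, E) x),
    ContinuousAlternatingMap.curryLeft (E := E) (Ω x) v = 0 → v = 0

/-! ### Hamiltonian 1-forms -/

/-- `v` is a Hamiltonian vector field of `F`: `dF = - ι_v Ω`. -/
def IsHamiltonianVF (Ω : Form E X 3) (F : Form E X 1) (v : VField E X) : Prop :=
  F.extDeriv = -v.interior Ω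

/-- The vector space `Ham(X)` of Hamiltonian (smooth) 1-forms. -/
def Ham (Ω : Form E X 3) : Submodule ℝ (Form E X 1) where
  carrier := {F | F.IsSmooth ∧ ∃ v : VField E X, IsHamiltonianVF Ω F v}
  zero_mem' := by
    have hz : (0 : Form E X 1) = (0 : ℝ) • (0 : Form E X 1) := by simp
    refine ⟨fun x₀ => ?_, 0, ?_⟩
    · rw [hz, inChart_smul, zero_smul]
      exact contDiffOn_const
    · unfold IsHamiltonianVF
      rw [hz, extDeriv_smul, zero_smul]
      funext x
      exact (neg_eq_zero.2 (map_zero (ContinuousAlternatingMap.curryLeft (E := E) (Ω x)))).symm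
  add_mem' := by
    rintro F G ⟨hF, v, hv⟩ ⟨hG, w, hw⟩
    refine ⟨fun x₀ => ?_, v + w, ?_⟩
    · rw [inChart_add]
      exact (hF x₀).add (hG x₀)
    · unfold IsHamiltonianVF at *
      rw [extDeriv_add hF hG, hv, hw, ← neg_add]
      funext x
      exact congrArg Neg.neg
        (map_add (ContinuousAlternatingMap.curryLeft (E := E) (Ω x)) (v x) (w x)).symm
  smul_mem' := by
    rintro c F ⟨hF, v, hv⟩
    refine ⟨fun x₀ => ?_, c • v, ?_⟩
    · rw [inChart_smul]
      exact contDiffOn_const.smul (hF x₀)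
    · unfold IsHamiltonianVF at *
      rw [extDeriv_smul, hv, smul_neg]
      funext x
      exact congrArg Neg.neg
        (map_smul (ContinuousAlternatingMap.curryLeft (E := E) (Ω x)) c (v x)).symm

/-- The Hamiltonian vector field `v_F`; it is unique when `Ω` is nondegenerate. -/
def hamVF {Ω : Form E X 3} (F : Ham Ω) : VField E X := F.2.2.choose

/-- `L` is the Lie 2-algebra `L(X,Ω)_h`: its differential, brackets, alternator and Jacobiator
(that is, all its data) are the prescribed ones. -/
structure IsHemistrictLie2 (Ω : Form E X 3) (L : Lie2Algebra ℝ (Ham Ω) (SmoothFun E X)) :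
    Prop where
  d_eq : ∀ f, (L.d f : Form E X 1) = differential f
  br00_eq : ∀ F G : Ham Ω, (L.br00 F G : Form E X 1) = (hamVF F).lieDeriv G
  br01_eq : ∀ (F : Ham Ω) f x, L.br01 F f x = (hamVF F).lieDerivFun f x
  br10_eq : ∀ f (F : Ham Ω), L.br10 f F = 0
  S_eq : ∀ (F G : Ham Ω) x,
    L.S F G x = -(((hamVF F).interior (G : Form E X 1)).value x
      + ((hamVF G).interior (F : Form E X 1)).value x)
  J_eq : L.IsHemistrict

/-- `L` is the Lie 2-algebra `L(X,Ω)_s`: its differential, brackets, alternator and Jacobiator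
(that is, all its data) are the prescribed ones. -/
structure IsSemistrictLie2 (Ω : Form E X 3) (L : Lie2Algebra ℝ (Ham Ω) (SmoothFun E X)) :
    Prop where
  d_eq : ∀ f, (L.d f : Form E X 1) = differential f
  br00_eq : ∀ F G : Ham Ω,
    (L.br00 F G : Form E X 1) = (hamVF G).interior ((hamVF F).interior Ω)
  br01_eq : ∀ (F : Ham Ω) f, L.br01 F f = 0
  br10_eq : ∀ f (F : Ham Ω), L.br10 f F = 0
  S_eq : L.IsSemistrict
  J_eq : ∀ (F G H : Ham Ω) x,
    L.J F G H x
      = -((hamVF F).interior ((hamVF G).interior ((hamVF H).interior Ω))).value x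

end TwoPlectic

end

/-! Write `s F G` for the contraction of `Ω` with `v_F` and then `v_G`, and `Φ F G` for the
contraction of `G` with `v_F`. Cartan's formula and `dG = -ι_{v_G} Ω` give `L_{v_F} G = s F G + d (Φ
F G)`. So the two brackets on `Ham Ω` differ by the exact term `d Φ`, and the hemistrict alternator
is minus the symmetrization of `Φ`.

The rest is algebra on a few identities, collected in `IsContraction`. The field `v_F` vanishes on
exact forms and sends `s` to the Lie bracket of vector fields. The identity `L_v ι_w = ι_[v,w] + ι_w
L_v` on 1-forms becomes `contract_d_contract`. The formula for `d` of a triple contraction of `Ω`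
becomes `jacobi`: the Jacobi identity for `s` holds up to an exact term.

These identities make `s + d Φ` a hemistrict Lie 2-algebra (`toHemistrict`). Subtracting `d Φ` again
moves the weakness from the alternator to the Jacobiator (`twist`): the new Jacobiator is the
Leibniz coboundary of `Φ`, which `coboundary_eq` computes as `Φ x (s y z)`, up to sign the triple
contraction of `Ω`. It is therefore antisymmetric, and its coherence law is the vanishing of a
squared coboundary. The identity chain map with homotopy `Φ` in one direction and `-Φ` in the other
gives inverse homomorphisms.

The geometric identities are proved for forms on a vector space, by the product rule for
contractions, and carried to the manifold by `inChart_extDeriv`, `inChart_interior` and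
`inChart_bracket`. -/

noncomputable section

open ContinuousAlternatingMap VectorField

/-! ### Contraction and exterior derivative of forms on a vector space -/

section Alternating

variable {E : Type*} [NormedAddCommGroup E] [NormedSpace ℝ E]

lemma ContinuousAlternatingMap.swap_three_left (T : E [⋀^Fin 3]→L[ℝ] ℝ) (a b c : E) :
    T ![b, a, c] = -T ![a, b, c] := by
  have h := T.toAlternatingMap.map_swap ![a, b, c] (i := 0) (j := 1) (by decide)
  refine Eq.trans ?_ h
  change T _ = T _
  congr 1
  ext i; fin_cases i <;> rfl

lemma ContinuousAlternatingMap.swap_three_right (T : E [⋀^Fin 3]→L[ℝ] ℝ) (a b c : E) :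
    T ![a, c, b] = -T ![a, b, c] := by
  have h := T.toAlternatingMap.map_swap ![a, b, c] (i := 1) (j := 2) (by decide)
  refine Eq.trans ?_ h
  change T _ = T _
  congr 1
  ext i; fin_cases i <;> rfl

lemma ContinuousAlternatingMap.sub_three (T : E [⋀^Fin 3]→L[ℝ] ℝ) (a a' b c : E) :
    T ![a - a', b, c] = T ![a, b, c] - T ![a', b, c] := by
  exact congrArg (fun S : E [⋀^Fin 2]→L[ℝ] ℝ => S ![b, c]) (map_sub (curryLeft T) a a')

lemma ContinuousAlternatingMap.sub_one (T : E [⋀^Fin 1]→L[ℝ] ℝ) (a a' : E) :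
    T ![a - a'] = T ![a] - T ![a'] := by
  exact congrArg (fun S : E [⋀^Fin 0]→L[ℝ] ℝ => S ![]) (map_sub (curryLeft T) a a')

lemma ContinuousAlternatingMap.ext_zero {S T : E [⋀^Fin 0]→L[ℝ] ℝ} (h : S ![] = T ![]) :
    S = T := by
  ext v; rw [Subsingleton.elim v ![]]; exact h

lemma ContinuousAlternatingMap.ext_one {S T : E [⋀^Fin 1]→L[ℝ] ℝ}
    (h : ∀ a, S ![a] = T ![a]) : S = T := by
  ext v
  have : v = ![v 0] := by ext i; fin_cases i; rfl
  rw [this]; exact h _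

lemma ContinuousAlternatingMap.ext_two {S T : E [⋀^Fin 2]→L[ℝ] ℝ}
    (h : ∀ a b, S ![a, b] = T ![a, b]) : S = T := by
  ext v
  have : v = ![v 0, v 1] := by ext i; fin_cases i <;> rfl
  rw [this]; exact h _ _

variable {k : ℕ} {p : E}

/-- Source of both the product rule and the smoothness of contractions of variable forms with
variable fields. -/
lemma isBoundedBilinearMap_curryLeft :
    IsBoundedBilinearMap ℝ (fun q : (E [⋀^Fin (k + 1)]→L[ℝ] ℝ) × E =>
      ContinuousAlternatingMap.curryLeft q.1 q.2) where
  add_left _ _ _ := rfl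
  smul_left _ _ _ := rfl
  add_right T x y := map_add T.curryLeft x y
  smul_right c T x := map_smul T.curryLeft c x
  -- Currying preserves the norm, so the constant 1 works.
  bound := ⟨1, one_pos, fun T x => by
    have := T.curryLeft.le_opNorm x
    rwa [norm_curryLeft, ← one_mul ‖T‖] at this⟩

lemma fderiv_curryLeft_apply {α : E → E [⋀^Fin (k + 1)]→L[ℝ] ℝ} {v : E → E}
    (hα : DifferentiableAt ℝ α p) (hv : DifferentiableAt ℝ v p) (u : E) :
    fderiv ℝ (fun y => ContinuousAlternatingMap.curryLeft (α y) (v y)) p u =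
      ContinuousAlternatingMap.curryLeft (fderiv ℝ α p u) (v p)
        + ContinuousAlternatingMap.curryLeft (α p) (fderiv ℝ v p u) := by
  have h := (isBoundedBilinearMap_curryLeft.hasFDerivAt (α p, v p)).comp p
    (hα.hasFDerivAt.prodMk hv.hasFDerivAt)
  exact (congrArg (fun L => L u) h.fderiv).trans (add_comm _ _)

lemma DifferentiableAt.curryLeft {α : E → E [⋀^Fin (k + 1)]→L[ℝ] ℝ} {v : E → E}
    (hα : DifferentiableAt ℝ α p) (hv : DifferentiableAt ℝ v p) :
    DifferentiableAt ℝ (fun y => ContinuousAlternatingMap.curryLeft (α y) (v y)) p := by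
  have h := (isBoundedBilinearMap_curryLeft.hasFDerivAt (α p, v p)).comp p
    (hα.hasFDerivAt.prodMk hv.hasFDerivAt)
  exact h.differentiableAt

lemma ContDiffOn.curryLeft {α : E → E [⋀^Fin (k + 1)]→L[ℝ] ℝ} {v : E → E} {s : Set E}
    {n : WithTop ℕ∞} (hα : ContDiffOn ℝ n α s) (hv : ContDiffOn ℝ n v s) :
    ContDiffOn ℝ n (fun y => ContinuousAlternatingMap.curryLeft (α y) (v y)) s := by
  have h := (isBoundedBilinearMap_curryLeft (E := E) (k := k)).contDiff (n := n)
  exact h.comp_contDiffOn (hα.prodMk hv)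

lemma ContDiffOn.extDeriv {α : E → E [⋀^Fin k]→L[ℝ] ℝ} {s : Set E} (hs : IsOpen s)
    (hα : ContDiffOn ℝ ∞ α s) : ContDiffOn ℝ ∞ (_root_.extDeriv α) s :=
  (alternatizeUncurryFinCLM ℝ E ℝ (n := k)).contDiff.comp_contDiffOn
    (hα.fderiv_of_isOpen hs (by simp))

lemma extDeriv_zero_apply (α : E → E [⋀^Fin 0]→L[ℝ] ℝ) (a : E) :
    extDeriv α p ![a] = fderiv ℝ α p a ![] := by
  simp [extDeriv, alternatizeUncurryFin_apply]

lemma extDeriv_one_apply (α : E → E [⋀^Fin 1]→L[ℝ] ℝ) (a b : E) :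
    extDeriv α p ![a, b] = fderiv ℝ α p a ![b] - fderiv ℝ α p b ![a] := by
  have h0 : (0 : Fin 2).removeNth ![a, b] = ![b] := by ext i; fin_cases i; rfl
  have h1 : (1 : Fin 2).removeNth ![a, b] = ![a] := by ext i; fin_cases i; rfl
  simp [extDeriv, alternatizeUncurryFin_apply, Fin.sum_univ_succ, h0, h1, sub_eq_add_neg]

lemma extDeriv_two_apply (α : E → E [⋀^Fin 2]→L[ℝ] ℝ) (a b c : E) :
    extDeriv α p ![a, b, c] = fderiv ℝ α p a ![b, c] - fderiv ℝ α p b ![a, c]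
      + fderiv ℝ α p c ![a, b] := by
  have h0 : (0 : Fin 3).removeNth ![a, b, c] = ![b, c] := by ext i; fin_cases i <;> rfl
  have h1 : (1 : Fin 3).removeNth ![a, b, c] = ![a, c] := by ext i; fin_cases i <;> rfl
  have h2 : (2 : Fin 3).removeNth ![a, b, c] = ![a, b] := by ext i; fin_cases i <;> rfl
  simp [extDeriv, alternatizeUncurryFin_apply, Fin.sum_univ_three, h0, h1, h2, sub_eq_add_neg]

lemma extDeriv_three_apply (α : E → E [⋀^Fin 3]→L[ℝ] ℝ) (a b c e : E) :
    extDeriv α p ![a, b, c, e] = fderiv ℝ α p a ![b, c, e] - fderiv ℝ α p b ![a, c, e]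
      + fderiv ℝ α p c ![a, b, e] - fderiv ℝ α p e ![a, b, c] := by
  have h0 : (0 : Fin 4).removeNth ![a, b, c, e] = ![b, c, e] := by ext i; fin_cases i <;> rfl
  have h1 : (1 : Fin 4).removeNth ![a, b, c, e] = ![a, c, e] := by ext i; fin_cases i <;> rfl
  have h2 : (2 : Fin 4).removeNth ![a, b, c, e] = ![a, b, e] := by ext i; fin_cases i <;> rfl
  have h3 : (3 : Fin 4).removeNth ![a, b, c, e] = ![a, b, c] := by ext i; fin_cases i <;> rfl
  simp [extDeriv, alternatizeUncurryFin_apply, Fin.sum_univ_four, h0, h1, h2, h3,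
    sub_eq_add_neg]
  norm_num

/-- A closed 3-form with closed contraction `ι_v Ω` is preserved by `v`. -/
lemma lie_closed_three {Ω : E → E [⋀^Fin 3]→L[ℝ] ℝ} {v : E → E}
    (hΩ : DifferentiableAt ℝ Ω p) (hv : DifferentiableAt ℝ v p) (h : extDeriv Ω p = 0)
    (h' : extDeriv (fun y => curryLeft (Ω y) (v y)) p = 0) (a b c : E) :
    fderiv ℝ Ω p (v p) ![a, b, c] + Ω p ![fderiv ℝ v p a, b, c] + Ω p ![a, fderiv ℝ v p b, c]
      + Ω p ![a, b, fderiv ℝ v p c] = 0 := by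
  -- Adding these two equations is Cartan's formula `L_v Ω = ι_v dΩ + d ι_v Ω`: the derivatives of
  -- `Ω` along `a`, `b`, `c` cancel.
  have e := congrArg (fun T => T ![v p, a, b, c]) h
  have e' := congrArg (fun T => T ![a, b, c]) h'
  simp only [extDeriv_three_apply, ContinuousAlternatingMap.coe_zero, Pi.zero_apply,
    extDeriv_two_apply,
    fderiv_curryLeft_apply hΩ hv, ContinuousAlternatingMap.add_apply, curryLeft_apply_apply] at e e'
  linarith [(Ω p).swap_three_left (fderiv ℝ v p b) a c, (Ω p).swap_three_right a (fderiv ℝ v p c) b,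
    (Ω p).swap_three_right a b (fderiv ℝ v p c),
    (Ω p).swap_three_left (fderiv ℝ v p c) a b]

/-- Since `v` and `w` both preserve `Ω`, one has `ι_[v,w] Ω = L_v ι_w Ω = d ι_v ι_w Ω`. This makes
the bracket of two Hamiltonian fields Hamiltonian. -/
lemma extDeriv_curryLeft_curryLeft {Ω : E → E [⋀^Fin 3]→L[ℝ] ℝ} {v w : E → E}
    (hΩ : DifferentiableAt ℝ Ω p) (hv : DifferentiableAt ℝ v p) (hw : DifferentiableAt ℝ w p)
    (h : extDeriv Ω p = 0) (h₁ : extDeriv (fun y => curryLeft (Ω y) (v y)) p = 0)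
    (h₂ : extDeriv (fun y => curryLeft (Ω y) (w y)) p = 0) :
    extDeriv (fun y => curryLeft (curryLeft (Ω y) (v y)) (w y)) p
      = -curryLeft (Ω p) (lieBracket ℝ v w p) := by
  refine ext_two fun a b => ?_
  have e := congrArg (fun T => T ![v p, w p, a, b]) h
  have e₁ := lie_closed_three hΩ hv h h₁ (w p) a b
  have e₂ := lie_closed_three hΩ hw h h₂ (v p) a b
  simp only [extDeriv_three_apply, ContinuousAlternatingMap.coe_zero, Pi.zero_apply,
    extDeriv_one_apply,
    fderiv_curryLeft_apply (hΩ.curryLeft hv) hw,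
    fderiv_curryLeft_apply hΩ hv, ContinuousAlternatingMap.add_apply, curryLeft_apply_apply,
    ContinuousAlternatingMap.neg_apply, lieBracket_eq] at e e₁ e₂ ⊢
  rw [sub_three]
  -- To `linarith`, values of `Ω p` on permuted arguments are unrelated atoms, so the needed
  -- antisymmetries are supplied by hand.
  have s1 := (Ω p).swap_three_left (v p) (fderiv ℝ w p a) b
  have s2 := (Ω p).swap_three_left (v p) (fderiv ℝ w p b) a
  have s3 := (Ω p).swap_three_right (v p) a (fderiv ℝ w p b)
  have s4 := (Ω p).swap_three_right (w p) a (fderiv ℝ v p b)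
  have s5 := (Ω p).swap_three_left (w p) (fderiv ℝ v p a) b
  have s6 := (Ω p).swap_three_left (w p) (fderiv ℝ v p b) a
  linarith

/-- Closedness at `(u, x, y, z)` trades the derivative of `Ω` along `u` for those along `x`, `y`,
`z`. Invariance of `Ω` under each field turns these into first derivatives of the fields, which pair
up into Lie brackets. -/
lemma extDeriv_curryLeft_curryLeft_curryLeft {Ω : E → E [⋀^Fin 3]→L[ℝ] ℝ} {x y z : E → E}
    (hΩ : DifferentiableAt ℝ Ω p) (hx : DifferentiableAt ℝ x p) (hy : DifferentiableAt ℝ y p)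
    (hz : DifferentiableAt ℝ z p) (h : extDeriv Ω p = 0)
    (h₁ : extDeriv (fun q => curryLeft (Ω q) (x q)) p = 0)
    (h₂ : extDeriv (fun q => curryLeft (Ω q) (y q)) p = 0)
    (h₃ : extDeriv (fun q => curryLeft (Ω q) (z q)) p = 0) :
    extDeriv (fun q => curryLeft (curryLeft (curryLeft (Ω q) (x q)) (y q)) (z q)) p
      = curryLeft (curryLeft (Ω p) (lieBracket ℝ x y p)) (z p)
        + curryLeft (curryLeft (Ω p) (y p)) (lieBracket ℝ x z p)
        - curryLeft (curryLeft (Ω p) (x p)) (lieBracket ℝ y z p) := by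
  refine ext_one fun u => ?_
  have e := congrArg (fun T => T ![u, x p, y p, z p]) h
  have e₁ := lie_closed_three hΩ hx h h₁ u (y p) (z p)
  have e₂ := lie_closed_three hΩ hy h h₂ u (x p) (z p)
  have e₃ := lie_closed_three hΩ hz h h₃ u (x p) (y p)
  have f2 (T : E [⋀^Fin 3]→L[ℝ] ℝ) (a b b' c : E) :
    T ![a, b - b', c] = T ![a, b, c] - T ![a, b', c] := by
    rw [T.swap_three_left, sub_three, T.swap_three_left a, T.swap_three_left a]; ring
  simp only [extDeriv_three_apply, ContinuousAlternatingMap.coe_zero, Pi.zero_apply,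
    extDeriv_zero_apply,
    fderiv_curryLeft_apply ((hΩ.curryLeft hx).curryLeft hy) hz,
    fderiv_curryLeft_apply (hΩ.curryLeft hx) hy,
    fderiv_curryLeft_apply hΩ hx, ContinuousAlternatingMap.add_apply, curryLeft_apply_apply,
    ContinuousAlternatingMap.sub_apply, lieBracket_eq, f2] at e e₁ e₂ e₃ ⊢
  rw [sub_three]
  have rot (a b c : E) : Ω p ![a, b, c] = Ω p ![b, c, a] := by
    rw [(Ω p).swap_three_left, (Ω p).swap_three_right]; ring
  have s1 := (Ω p).swap_three_left (x p) (fderiv ℝ y p u) (z p)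
  have s2 := rot (fderiv ℝ z p u) (x p) (y p)
  have s3 := rot u (fderiv ℝ x p (y p)) (z p)
  have s4 := rot u (y p) (fderiv ℝ x p (z p))
  have s5 := rot u (fderiv ℝ y p (x p)) (z p)
  have s6 := rot u (x p) (fderiv ℝ y p (z p))
  have s7 := rot u (x p) (fderiv ℝ z p (y p))
  have s8 := (Ω p).swap_three_left u (fderiv ℝ z p (x p)) (y p)
  have s9 := rot u (y p) (fderiv ℝ z p (x p))
  have s10 := rot (fderiv ℝ z p (x p)) u (y p)
  have s11 := (Ω p).swap_three_right u (y p) (fderiv ℝ z p (x p))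
  linarith

/-- The classical invariant formula for `dG(v, w)`; the terms differentiating `v` and `w` combine
into the bracket. -/
lemma curryLeft_curryLeft_extDeriv_one {G : E → E [⋀^Fin 1]→L[ℝ] ℝ} {v w : E → E}
    (hG : DifferentiableAt ℝ G p) (hv : DifferentiableAt ℝ v p) (hw : DifferentiableAt ℝ w p) :
    curryLeft (curryLeft (extDeriv G p) (v p)) (w p)
      = curryLeft (extDeriv (fun y => curryLeft (G y) (w y)) p) (v p)
        - curryLeft (extDeriv (fun y => curryLeft (G y) (v y)) p) (w p)
        - curryLeft (G p) (lieBracket ℝ v w p) := by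
  refine ext_zero ?_
  simp only [extDeriv_one_apply, extDeriv_zero_apply, fderiv_curryLeft_apply hG hv,
    fderiv_curryLeft_apply hG hw, ContinuousAlternatingMap.add_apply, curryLeft_apply_apply,
    ContinuousAlternatingMap.sub_apply, lieBracket_eq]
  rw [sub_one]
  ring

/-- Cartan's formula for 1-forms. -/
lemma cartan_one {G : E → E [⋀^Fin 1]→L[ℝ] ℝ} {v : E → E}
    (hG : DifferentiableAt ℝ G p) (hv : DifferentiableAt ℝ v p) :
    fderiv ℝ G p (v p) + (G p).compContinuousLinearMap (fderiv ℝ v p)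
      = curryLeft (extDeriv G p) (v p) + extDeriv (fun y => curryLeft (G y) (v y)) p := by
  refine ext_one fun a => ?_
  have : (⇑(fderiv ℝ v p) ∘ ![a]) = ![fderiv ℝ v p a] := by ext i; fin_cases i; rfl
  simp [extDeriv_one_apply, extDeriv_zero_apply, fderiv_curryLeft_apply hG hv, this]
  ring

end Alternating

end

/-! ### Chart independence of forms, exterior derivatives and fields -/

noncomputable section

namespace TwoPlectic

open ContinuousAlternatingMap VectorField Filter Topology

variable {E : Type*} [NormedAddCommGroup E] [NormedSpace ℝ E]
  {X : Type*} [TopologicalSpace X] [ChartedSpace E X] [IsManifold 𝓘(ℝ, E) ∞ X]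

lemma contMDiffAt_extChartAt_symm {x₀ : X} {y : E} (hy : y ∈ (extChartAt 𝓘(ℝ, E) x₀).target) :
    ContMDiffAt 𝓘(ℝ, E) 𝓘(ℝ, E) ∞ (extChartAt 𝓘(ℝ, E) x₀).symm y :=
  (contMDiffOn_extChartAt_symm x₀).contMDiffAt ((isOpen_extChartAt_target x₀).mem_nhds hy)

lemma mdifferentiableAt_extChartAt_symm {x₀ : X} {y : E}
    (hy : y ∈ (extChartAt 𝓘(ℝ, E) x₀).target) :
    MDifferentiableAt 𝓘(ℝ, E) 𝓘(ℝ, E) (extChartAt 𝓘(ℝ, E) x₀).symm y :=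
  (contMDiffAt_extChartAt_symm hy).mdifferentiableAt (by simp)

lemma mdifferentiableAt_extChartAt' {x₀ x : X} (hx : x ∈ (extChartAt 𝓘(ℝ, E) x₀).source) :
    MDifferentiableAt 𝓘(ℝ, E) 𝓘(ℝ, E) (extChartAt 𝓘(ℝ, E) x₀) x :=
  mdifferentiableAt_extChartAt (by rwa [extChartAt_source] at hx)

/-- The transition map between two extended charts. -/
def transition (x₀ x₁ : X) : E → E := extChartAt 𝓘(ℝ, E) x₁ ∘ (extChartAt 𝓘(ℝ, E) x₀).symm

lemma isInvertible_mfderiv_extChartAt_symm {x₀ : X} {y : E}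
    (hy : y ∈ (extChartAt 𝓘(ℝ, E) x₀).target) :
    (mfderiv 𝓘(ℝ, E) 𝓘(ℝ, E) (extChartAt 𝓘(ℝ, E) x₀).symm y).IsInvertible := by
  have h := isInvertible_mfderivWithin_extChartAt_symm hy
  rwa [modelWithCornersSelf_coe, Set.range_id, mfderivWithin_univ] at h

lemma mfderiv_extChartAt_symm_comp {x₀ x : X} (hx : x ∈ (extChartAt 𝓘(ℝ, E) x₀).source)
    (u : TangentSpace 𝓘(ℝ, E) x) :
    mfderiv 𝓘(ℝ, E) 𝓘(ℝ, E) (extChartAt 𝓘(ℝ, E) x₀).symm (extChartAt 𝓘(ℝ, E) x₀ x)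
      (mfderiv 𝓘(ℝ, E) 𝓘(ℝ, E) (extChartAt 𝓘(ℝ, E) x₀) x u) = u := by
  have h := mfderivWithin_extChartAt_symm_comp_mfderiv_extChartAt' hx
  rw [modelWithCornersSelf_coe, Set.range_id, mfderivWithin_univ] at h
  exact congrArg (fun L => L u) h

lemma mfderiv_extChartAt_comp_symm {x₀ : X} {y : E} (hy : y ∈ (extChartAt 𝓘(ℝ, E) x₀).target)
    (u : E) :
    mfderiv 𝓘(ℝ, E) 𝓘(ℝ, E) (extChartAt 𝓘(ℝ, E) x₀) ((extChartAt 𝓘(ℝ, E) x₀).symm y)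
      (mfderiv 𝓘(ℝ, E) 𝓘(ℝ, E) (extChartAt 𝓘(ℝ, E) x₀).symm y u) = u := by
  have h := mfderiv_extChartAt_comp_mfderivWithin_extChartAt_symm hy
  rw [modelWithCornersSelf_coe, Set.range_id, mfderivWithin_univ] at h
  exact congrArg (fun L => L u) h

lemma eventually_mem_transition_source {x₀ x₁ : X} {y : E}
    (hy : y ∈ (extChartAt 𝓘(ℝ, E) x₀).target)
    (hy₁ : (extChartAt 𝓘(ℝ, E) x₀).symm y ∈ (extChartAt 𝓘(ℝ, E) x₁).source) :
    ∀ᶠ z in 𝓝 y, z ∈ (extChartAt 𝓘(ℝ, E) x₀).target ∧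
      (extChartAt 𝓘(ℝ, E) x₀).symm z ∈ (extChartAt 𝓘(ℝ, E) x₁).source :=
  Filter.Eventually.and ((isOpen_extChartAt_target x₀).mem_nhds hy)
    ((mdifferentiableAt_extChartAt_symm hy).continuousAt.preimage_mem_nhds
      ((isOpen_extChartAt_source x₁).mem_nhds hy₁))

lemma contDiffAt_transition {x₀ x₁ : X} {y : E} (hy : y ∈ (extChartAt 𝓘(ℝ, E) x₀).target)
    (hy₁ : (extChartAt 𝓘(ℝ, E) x₀).symm y ∈ (extChartAt 𝓘(ℝ, E) x₁).source) :
    ContDiffAt ℝ ∞ (transition x₀ x₁ : E → E) y := by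
  rw [← contMDiffAt_iff_contDiffAt]
  exact (contMDiffAt_extChartAt' (by rwa [extChartAt_source] at hy₁)).comp y
    (contMDiffAt_extChartAt_symm hy)

lemma fderiv_transition {x₀ x₁ : X} {y : E} (hy : y ∈ (extChartAt 𝓘(ℝ, E) x₀).target)
    (hy₁ : (extChartAt 𝓘(ℝ, E) x₀).symm y ∈ (extChartAt 𝓘(ℝ, E) x₁).source) (u : E) :
    fderiv ℝ (transition x₀ x₁ : E → E) y u =
      mfderiv 𝓘(ℝ, E) 𝓘(ℝ, E) (extChartAt 𝓘(ℝ, E) x₁) ((extChartAt 𝓘(ℝ, E) x₀).symm y)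
        (mfderiv 𝓘(ℝ, E) 𝓘(ℝ, E) (extChartAt 𝓘(ℝ, E) x₀).symm y u) := by
  rw [← mfderiv_eq_fderiv]
  exact congrArg (fun L => L u)
    (mfderiv_comp y (mdifferentiableAt_extChartAt' hy₁) (mdifferentiableAt_extChartAt_symm hy))

omit [IsManifold 𝓘(ℝ, E) ∞ X] in
lemma minSmoothness_two_le_infty : minSmoothness ℝ 2 ≤ (∞ : WithTop ℕ∞) := by
  simpa using WithTop.coe_le_coe.2 (le_top : (2 : ℕ∞) ≤ ⊤)

variable {k : ℕ}

omit [IsManifold 𝓘(ℝ, E) ∞ X] in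
-- All tangent spaces are definitionally `E`, so values at propositionally equal points can be
-- compared on model vectors without transport.
lemma Form.apply_congr (α : Form E X k) {x x' : X} (h : x = x') (u : Fin k → E) :
    (α x : (Fin k → E) → ℝ) u = (α x' : (Fin k → E) → ℝ) u := by
  subst h; rfl

lemma inChart_transition (α : Form E X k) {x₀ x₁ : X} {y : E}
    (hy : y ∈ (extChartAt 𝓘(ℝ, E) x₀).target)
    (hy₁ : (extChartAt 𝓘(ℝ, E) x₀).symm y ∈ (extChartAt 𝓘(ℝ, E) x₁).source) :
    α.inChart x₀ y = (α.inChart x₁ (transition x₀ x₁ y)).compContinuousLinearMap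
      (fderiv ℝ (transition x₀ x₁ : E → E) y) := by
  ext u
  refine Eq.trans ?_ (α.apply_congr ((extChartAt 𝓘(ℝ, E) x₁).left_inv hy₁).symm _)
  refine congrArg (α ((extChartAt 𝓘(ℝ, E) x₀).symm y) : (Fin k → E) → ℝ) (funext fun i => ?_)
  refine (mfderiv_extChartAt_symm_comp hy₁ _).symm.trans ?_
  exact congrArg (fun w : E => (mfderiv 𝓘(ℝ, E) 𝓘(ℝ, E) (extChartAt 𝓘(ℝ, E) x₁).symm
    (transition x₀ x₁ y) w : E)) (fderiv_transition hy hy₁ (u i)).symm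

omit [IsManifold 𝓘(ℝ, E) ∞ X] in
lemma Form.IsSmooth.differentiableAt_inChart {α : Form E X k} (hα : α.IsSmooth) {x₀ : X} {y : E}
    (hy : y ∈ (extChartAt 𝓘(ℝ, E) x₀).target) : DifferentiableAt ℝ (α.inChart x₀) y :=
  ((hα x₀).contDiffAt ((isOpen_extChartAt_target x₀).mem_nhds hy)).differentiableAt (by simp)

/-- The exterior derivative is defined at each point through the chart preferred there. Naturality
of `d` under the transition map lets one fixed chart compute it at all points of its domain, as
needed for smoothness and for `d² = 0`. -/
lemma inChart_extDeriv {α : Form E X k} (hα : α.IsSmooth) {x₀ : X} {y : E}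
    (hy : y ∈ (extChartAt 𝓘(ℝ, E) x₀).target) :
    α.extDeriv.inChart x₀ y = _root_.extDeriv (α.inChart x₀) y := by
  set x₁ := (extChartAt 𝓘(ℝ, E) x₀).symm y with hx₁
  have hy₁ : (extChartAt 𝓘(ℝ, E) x₀).symm y ∈ (extChartAt 𝓘(ℝ, E) x₁).source :=
    mem_extChartAt_source x₁
  have h : α.inChart x₀ =ᶠ[𝓝 y] fun z => (α.inChart x₁
      (transition x₀ x₁ z)).compContinuousLinearMap (fderiv ℝ (transition x₀ x₁ : E → E) z) := by
    filter_upwards [eventually_mem_transition_source hy hy₁] with z hz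
    exact inChart_transition α hz.1 hz.2
  rw [h.extDeriv_eq, extDeriv_pullback (f := transition x₀ x₁) (r := ∞)
    (hα.differentiableAt_inChart ((extChartAt 𝓘(ℝ, E) x₁).map_source hy₁))
    (contDiffAt_transition hy hy₁) minSmoothness_two_le_infty]
  ext u
  refine congrArg (_root_.extDeriv (α.inChart x₁) (transition x₀ x₁ y))
    (funext fun i => (fderiv_transition hy hy₁ (u i)).symm)

lemma Form.IsSmooth.extDeriv {α : Form E X k} (hα : α.IsSmooth) : α.extDeriv.IsSmooth :=
  fun x₀ => ((hα x₀).extDeriv (isOpen_extChartAt_target x₀)).congr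
    fun _ hy => inChart_extDeriv hα hy

/-- The derivative of the chart is invertible, so a form at `x` is recovered from its chart
expression at the single point representing `x`. -/
lemma Form.ext_inChart {α β : Form E X k}
    (h : ∀ x, α.inChart x (extChartAt 𝓘(ℝ, E) x x) = β.inChart x (extChartAt 𝓘(ℝ, E) x x)) :
    α = β := by
  have key (γ : Form E X k) (x : X) : γ x = (γ.inChart x (extChartAt 𝓘(ℝ, E) x
      x)).compContinuousLinearMap (mfderiv 𝓘(ℝ, E) 𝓘(ℝ, E) (extChartAt 𝓘(ℝ, E) x) x) := by
    ext u
    refine (congrArg (α := Fin k → E) (γ x) (funext fun i => ?_)).trans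
      (γ.apply_congr (extChartAt_to_inv (I := 𝓘(ℝ, E)) x).symm _)
    exact (mfderiv_extChartAt_symm_comp (mem_extChartAt_source (I := 𝓘(ℝ, E)) x) _).symm
  funext x
  rw [key α, key β, h]

lemma extDeriv_extDeriv {α : Form E X k} (hα : α.IsSmooth) : α.extDeriv.extDeriv = 0 := by
  refine Form.ext_inChart fun x => ?_
  have hx := mem_extChartAt_target (I := 𝓘(ℝ, E)) x
  have hn := (isOpen_extChartAt_target (I := 𝓘(ℝ, E)) x).mem_nhds hx
  rw [inChart_extDeriv hα.extDeriv hx]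
  have h : α.extDeriv.inChart x =ᶠ[𝓝 (extChartAt 𝓘(ℝ, E) x x)] _root_.extDeriv (α.inChart x) := by
    filter_upwards [hn] with z hz
    exact inChart_extDeriv hα hz
  rw [h.extDeriv_eq, extDeriv_extDeriv_apply ((hα x).contDiffAt hn) minSmoothness_two_le_infty]
  rfl

/-! ### Vector fields in charts -/

lemma mfderiv_inChart (v : VField E X) {x₀ : X} {y : E}
    (hy : y ∈ (extChartAt 𝓘(ℝ, E) x₀).target) :
    mfderiv 𝓘(ℝ, E) 𝓘(ℝ, E) (extChartAt 𝓘(ℝ, E) x₀).symm y (v.inChart x₀ y)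
      = v ((extChartAt 𝓘(ℝ, E) x₀).symm y) :=
  (isInvertible_mfderiv_extChartAt_symm hy).self_apply_inverse _

lemma inChart_interior (v : VField E X) (α : Form E X (k + 1)) {x₀ : X} {y : E}
    (hy : y ∈ (extChartAt 𝓘(ℝ, E) x₀).target) :
    (v.interior α).inChart x₀ y = curryLeft (α.inChart x₀ y) (v.inChart x₀ y) := by
  ext u
  refine congrArg (α ((extChartAt 𝓘(ℝ, E) x₀).symm y) : (Fin (k + 1) → E) → ℝ)
    (funext fun i => ?_)
  -- Only the slot filled by `v` needs an argument: the chart derivative undoes the pullback of `v`.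
  refine Fin.cases ?_ (fun j => rfl) i
  exact (mfderiv_inChart v hy).symm

lemma contDiffOn_inChart [FiniteDimensional ℝ E] (v : VField E X) (x₀ : X) :
    ContDiffOn ℝ ∞ (v.inChart x₀) (extChartAt 𝓘(ℝ, E) x₀).target := by
  have : CompleteSpace E := FiniteDimensional.complete ℝ E
  -- Pulling back a field costs one derivative, and `∞ + 1` is definitionally `∞`.
  have : IsManifold 𝓘(ℝ, E) (∞ + 1) X := inferInstanceAs (IsManifold 𝓘(ℝ, E) ∞ X)
  intro y hy
  refine ContDiffAt.contDiffWithinAt ?_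
  refine contMDiffAt_vectorSpace_iff_contDiffAt.1 ?_
  exact ContMDiffAt.mpullback_vectorField_preimage (n := ∞) (v.contMDiff _)
    (contMDiffAt_extChartAt_symm hy) (isInvertible_mfderiv_extChartAt_symm hy) (by simp)

end TwoPlectic
end

noncomputable section

namespace TwoPlectic

open ContinuousAlternatingMap VectorField Filter Topology

variable {E : Type*} [NormedAddCommGroup E] [NormedSpace ℝ E]
  {X : Type*} [TopologicalSpace X] [ChartedSpace E X] [IsManifold 𝓘(ℝ, E) ∞ X] {k : ℕ}

/-! ### Functions as 0-forms -/

variable (E) in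
/-- A function, as a 0-form. -/
def ofFun (f : X → ℝ) : Form E X 0 := fun x =>
  ContinuousAlternatingMap.constOfIsEmpty ℝ (TangentSpace 𝓘(ℝ, E) x) (Fin 0) (f x)

omit [IsManifold 𝓘(ℝ, E) ∞ X] in
lemma ofFun_value (α : Form E X 0) : ofFun E α.value = α :=
  funext fun _ => ContinuousAlternatingMap.ext_zero (E := E) rfl

lemma isSmooth_ofFun {f : X → ℝ} (hf : ContMDiff 𝓘(ℝ, E) 𝓘(ℝ, ℝ) ∞ f) :
    (ofFun E f).IsSmooth := fun x₀ =>
  (constOfIsEmptyLIE ℝ E ℝ (Fin 0)).contDiff.comp_contDiffOn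
    (contMDiffOn_iff_contDiffOn.1 (hf.comp_contMDiffOn (contMDiffOn_extChartAt_symm x₀)))

omit [IsManifold 𝓘(ℝ, E) ∞ X] in
lemma Form.IsSmooth.contMDiff_value {α : Form E X 0} (hα : α.IsSmooth) :
    ContMDiff 𝓘(ℝ, E) 𝓘(ℝ, ℝ) ∞ α.value := by
  intro x
  have h : ContDiffOn ℝ ∞ (α.value ∘ (extChartAt 𝓘(ℝ, E) x).symm)
      (extChartAt 𝓘(ℝ, E) x).target := by
    refine ((constOfIsEmptyLIE ℝ E ℝ (Fin 0)).symm.contDiff.comp_contDiffOn (hα x)).congr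
      fun y _ => ?_
    refine congrArg (α ((extChartAt 𝓘(ℝ, E) x).symm y) : (Fin 0 → E) → ℝ)
      (Subsingleton.elim _ _)
  have h' : ContMDiffAt 𝓘(ℝ, E) 𝓘(ℝ, ℝ) ∞ ((α.value ∘ (extChartAt 𝓘(ℝ, E) x).symm)
      ∘ extChartAt 𝓘(ℝ, E) x) x :=
    ((contMDiffOn_iff_contDiffOn.2 h).contMDiffAt ((isOpen_extChartAt_target x).mem_nhds
      (mem_extChartAt_target x))).comp x contMDiffAt_extChartAt
  refine h'.congr_of_eventuallyEq ?_
  filter_upwards [extChartAt_source_mem_nhds (I := 𝓘(ℝ, E)) x] with z hz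
  exact congrArg α.value ((extChartAt 𝓘(ℝ, E) x).left_inv hz).symm

/-- Lets linearity, smoothness and `d² = 0` for functions be inherited from forms. -/
lemma differential_eq_extDeriv {f : X → ℝ} (hf : ContMDiff 𝓘(ℝ, E) 𝓘(ℝ, ℝ) ∞ f) :
    differential f = (ofFun E f).extDeriv := by
  refine Form.ext_inChart fun x => ?_
  have hx := mem_extChartAt_target (I := 𝓘(ℝ, E)) x
  rw [inChart_extDeriv (isSmooth_ofFun hf) hx]
  refine Eq.trans ?_ (extDeriv_constOfIsEmpty (f ∘ (extChartAt 𝓘(ℝ, E) x).symm) _).symm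
  refine ContinuousAlternatingMap.ext_one fun a => ?_
  have h := mfderiv_comp (extChartAt 𝓘(ℝ, E) x x)
    (hf.mdifferentiableAt (by simp)) (mdifferentiableAt_extChartAt_symm hx)
  rw [mfderiv_eq_fderiv] at h
  exact (congrArg (fun L => L a) h).symm

lemma isSmooth_differential {f : X → ℝ} (hf : ContMDiff 𝓘(ℝ, E) 𝓘(ℝ, ℝ) ∞ f) :
    (differential f : Form E X 1).IsSmooth := by
  rw [differential_eq_extDeriv hf]
  exact (isSmooth_ofFun hf).extDeriv

lemma extDeriv_differential {f : X → ℝ} (hf : ContMDiff 𝓘(ℝ, E) 𝓘(ℝ, ℝ) ∞ f) :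
    (differential f : Form E X 1).extDeriv = 0 := by
  rw [differential_eq_extDeriv hf, extDeriv_extDeriv (isSmooth_ofFun hf)]

lemma Form.IsSmooth.extDeriv_eq_differential {α : Form E X 0} (hα : α.IsSmooth) :
    α.extDeriv = differential α.value := by
  rw [differential_eq_extDeriv hα.contMDiff_value, ofFun_value]

/-! ### The interior product -/

lemma add_interior (v w : VField E X) (α : Form E X (k + 1)) :
    (v + w).interior α = v.interior α + w.interior α :=
  funext fun x => map_add (ContinuousAlternatingMap.curryLeft (E := E) (α x)) (v x) (w x)

lemma smul_interior (c : ℝ) (v : VField E X) (α : Form E X (k + 1)) :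
    (c • v).interior α = c • v.interior α :=
  funext fun x => map_smul (ContinuousAlternatingMap.curryLeft (E := E) (α x)) c (v x)

lemma zero_interior (α : Form E X (k + 1)) : (0 : VField E X).interior α = 0 :=
  funext fun x => map_zero (ContinuousAlternatingMap.curryLeft (E := E) (α x))

lemma interior_add (v : VField E X) (α β : Form E X (k + 1)) :
    v.interior (α + β) = v.interior α + v.interior β := rfl

lemma interior_smul (v : VField E X) (c : ℝ) (α : Form E X (k + 1)) :
    v.interior (c • α) = c • v.interior α := rfl

lemma interior_neg (v : VField E X) (α : Form E X (k + 1)) :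
    v.interior (-α) = -v.interior α := rfl

lemma interior_zero (v : VField E X) : v.interior (0 : Form E X (k + 1)) = 0 := rfl

lemma interior_interior_swap (v w : VField E X) (α : Form E X (k + 2)) :
    v.interior (w.interior α) = -w.interior (v.interior α) := by
  funext x
  have h : ∀ T : E [⋀^Fin (k + 2)]→L[ℝ] ℝ, ∀ a b : E,
      curryLeft (curryLeft T b) a = -curryLeft (curryLeft T a) b := by
    intro T a b
    -- Polarization of the alternating property.
    have := curryLeft_same T (a + b)
    have e : curryLeft (curryLeft T (a + b)) (a + b) = curryLeft (curryLeft T a) a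
        + curryLeft (curryLeft T b) a + (curryLeft (curryLeft T a) b
        + curryLeft (curryLeft T b) b) := by
      rw [map_add, map_add]
      rfl
    rw [e, curryLeft_same, curryLeft_same, zero_add, add_zero] at this
    exact eq_neg_of_add_eq_zero_left this
  exact h (α x) (v x) (w x)

lemma isSmooth_interior [FiniteDimensional ℝ E] (v : VField E X) {α : Form E X (k + 1)}
    (hα : α.IsSmooth) : (v.interior α).IsSmooth := fun x₀ =>
  ((hα x₀).curryLeft (contDiffOn_inChart v x₀)).congr fun _ hy => inChart_interior v α hy

/-! ### Cartan calculus -/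

variable [FiniteDimensional ℝ E]

lemma differentiableAt_inChart (v : VField E X) {x₀ : X} {y : E}
    (hy : y ∈ (extChartAt 𝓘(ℝ, E) x₀).target) : DifferentiableAt ℝ (v.inChart x₀) y :=
  ((contDiffOn_inChart v x₀).contDiffAt
    ((isOpen_extChartAt_target x₀).mem_nhds hy)).differentiableAt (by simp)

omit [FiniteDimensional ℝ E] in
lemma isManifold_minSmoothness : IsManifold 𝓘(ℝ, E) (minSmoothness ℝ 2) X :=
  IsManifold.of_le minSmoothness_two_le_infty

/-- The Lie bracket of vector fields. -/
def bracket (v w : VField E X) : VField E X where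
  toFun := mlieBracket 𝓘(ℝ, E) v w
  contMDiff_toFun x := by
    have : CompleteSpace E := FiniteDimensional.complete ℝ E
    have : IsManifold 𝓘(ℝ, E) ((⊤ : ℕ∞) + 1) X := inferInstanceAs (IsManifold 𝓘(ℝ, E) ∞ X)
    have : IsManifold 𝓘(ℝ, E) (minSmoothness ℝ 2) X := isManifold_minSmoothness
    exact ContMDiffAt.mlieBracket_vectorField (m := ⊤) (n := ⊤) (v.contMDiff x) (w.contMDiff x)
      (by simp)

/-- Naturality of the Lie bracket under pullback by the inverse chart. -/
lemma inChart_bracket (v w : VField E X) {x₀ : X} {y : E}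
    (hy : y ∈ (extChartAt 𝓘(ℝ, E) x₀).target) :
    (bracket v w).inChart x₀ y = lieBracket ℝ (v.inChart x₀) (w.inChart x₀) y := by
  have : CompleteSpace E := FiniteDimensional.complete ℝ E
  have : IsManifold 𝓘(ℝ, E) (∞ + 1) X := inferInstanceAs (IsManifold 𝓘(ℝ, E) ∞ X)
  have : IsManifold 𝓘(ℝ, E) (minSmoothness ℝ 2) X := isManifold_minSmoothness
  refine (mpullback_mlieBracket (n := ∞) ((v.contMDiff _).mdifferentiableAt (by simp))
    ((w.contMDiff _).mdifferentiableAt (by simp)) (contMDiffAt_extChartAt_symm hy) minSmoothness_two_le_infty).trans ?_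
  rw [← mlieBracketWithin_univ, mlieBracketWithin_eq_lieBracketWithin]
  exact congrFun lieBracketWithin_univ y

omit [FiniteDimensional ℝ E] in
lemma inChart_interior_eventuallyEq (v : VField E X) (α : Form E X (k + 1)) {x₀ : X} {y : E}
    (hy : y ∈ (extChartAt 𝓘(ℝ, E) x₀).target) :
    (v.interior α).inChart x₀ =ᶠ[𝓝 y] fun z => curryLeft (α.inChart x₀ z) (v.inChart x₀ z) := by
  filter_upwards [(isOpen_extChartAt_target x₀).mem_nhds hy] with z hz
  exact inChart_interior v α hz

lemma inChart_extDeriv_interior (v : VField E X) {α : Form E X (k + 1)} (hα : α.IsSmooth)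
    {x₀ : X} {y : E} (hy : y ∈ (extChartAt 𝓘(ℝ, E) x₀).target) :
    (v.interior α).extDeriv.inChart x₀ y
      = _root_.extDeriv (fun z => curryLeft (α.inChart x₀ z) (v.inChart x₀ z)) y := by
  rw [inChart_extDeriv (isSmooth_interior v hα) hy,
    (inChart_interior_eventuallyEq v α hy).extDeriv_eq]

/-- Cartan's formula. -/
lemma lieDeriv_eq (v : VField E X) {G : Form E X 1} (hG : G.IsSmooth) :
    v.lieDeriv G = v.interior G.extDeriv + (v.interior G).extDeriv := by
  refine Form.ext_inChart fun x => ?_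
  have hx := mem_extChartAt_target (I := 𝓘(ℝ, E)) x
  rw [inChart_add, Pi.add_apply, inChart_interior v _ hx, inChart_extDeriv hG hx,
    inChart_extDeriv_interior v hG hx,
    ← cartan_one (hG.differentiableAt_inChart hx) (differentiableAt_inChart v hx)]
  -- The Lie derivative is by definition a pullback along the chart derivative at `x`; reading it in
  -- that same chart undoes the pullback.
  have key (T : E [⋀^Fin 1]→L[ℝ] ℝ) (T' : Form E X 1)
      (h : T' x = T.compContinuousLinearMap (mfderiv 𝓘(ℝ, E) 𝓘(ℝ, E) (extChartAt 𝓘(ℝ, E) x) x)) :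
      T'.inChart x (extChartAt 𝓘(ℝ, E) x x) = T := by
    ext u
    refine (T'.apply_congr (extChartAt_to_inv (I := 𝓘(ℝ, E)) x) _).trans ?_
    rw [h]
    refine congrArg (T : (Fin 1 → E) → ℝ) (funext fun i => ?_)
    have := mfderiv_extChartAt_comp_symm hx (u i)
    rw [extChartAt_to_inv (I := 𝓘(ℝ, E)) x] at this
    exact this
  exact key _ _ rfl

/-- By Cartan's formula this is `L_v ι_w G = ι_[v,w] G + ι_w L_v G` rearranged, the form used for
`contract_d_contract`. -/
lemma interior_interior_extDeriv (v w : VField E X) {G : Form E X 1} (hG : G.IsSmooth) :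
    w.interior (v.interior G.extDeriv) = v.interior (w.interior G).extDeriv
      - w.interior (v.interior G).extDeriv - (bracket v w).interior G := by
  refine Form.ext_inChart fun x => ?_
  have hx := mem_extChartAt_target (I := 𝓘(ℝ, E)) x
  have h := curryLeft_curryLeft_extDeriv_one (hG.differentiableAt_inChart hx)
    (differentiableAt_inChart v hx) (differentiableAt_inChart w hx)
  rw [← inChart_extDeriv hG hx, ← inChart_interior v _ hx, ← inChart_interior w _ hx,
    ← inChart_extDeriv_interior v hG hx, ← inChart_extDeriv_interior w hG hx,
    ← inChart_bracket v w hx, ← inChart_interior _ _ hx, ← inChart_interior _ _ hx,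
    ← inChart_interior _ _ hx] at h
  exact h

lemma extDeriv_interior_interior {Ω : Form E X 3} (hΩ : Ω.IsSmooth) (h : Ω.extDeriv = 0)
    {v w : VField E X} (hv : (v.interior Ω).extDeriv = 0) (hw : (w.interior Ω).extDeriv = 0) :
    (w.interior (v.interior Ω)).extDeriv = -(bracket v w).interior Ω := by
  refine Form.ext_inChart fun x => ?_
  have hx := mem_extChartAt_target (I := 𝓘(ℝ, E)) x
  rw [inChart_extDeriv_interior w (isSmooth_interior v hΩ) hx]
  -- The exterior derivative sees the germ, so the chart formula for the contraction is needed near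
  -- the point, not only at it.
  have e : (fun z => curryLeft ((v.interior Ω).inChart x z) (w.inChart x z))
      =ᶠ[𝓝 (extChartAt 𝓘(ℝ, E) x x)] fun z =>
        curryLeft (curryLeft (Ω.inChart x z) (v.inChart x z)) (w.inChart x z) := by
    filter_upwards [inChart_interior_eventuallyEq v Ω hx] with z hz
    rw [hz]
  rw [e.extDeriv_eq, extDeriv_curryLeft_curryLeft (hΩ.differentiableAt_inChart hx)
    (differentiableAt_inChart v hx) (differentiableAt_inChart w hx)
    (by rw [← inChart_extDeriv hΩ hx, h]; rfl)
    (by rw [← inChart_extDeriv_interior v hΩ hx, hv]; rfl)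
    (by rw [← inChart_extDeriv_interior w hΩ hx, hw]; rfl),
    ← inChart_bracket v w hx, ← inChart_interior _ _ hx]
  rfl

lemma extDeriv_interior_interior_interior {Ω : Form E X 3} (hΩ : Ω.IsSmooth)
    (h : Ω.extDeriv = 0) {x y z : VField E X} (hx : (x.interior Ω).extDeriv = 0)
    (hy : (y.interior Ω).extDeriv = 0) (hz : (z.interior Ω).extDeriv = 0) :
    (z.interior (y.interior (x.interior Ω))).extDeriv
      = z.interior ((bracket x y).interior Ω) + (bracket x z).interior (y.interior Ω)
        - (bracket y z).interior (x.interior Ω) := by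
  refine Form.ext_inChart fun p => ?_
  have hp := mem_extChartAt_target (I := 𝓘(ℝ, E)) p
  rw [inChart_extDeriv_interior z (isSmooth_interior y (isSmooth_interior x hΩ)) hp]
  have e : (fun q => curryLeft ((y.interior (x.interior Ω)).inChart p q) (z.inChart p q))
      =ᶠ[𝓝 (extChartAt 𝓘(ℝ, E) p p)] fun q => curryLeft
        (curryLeft (curryLeft (Ω.inChart p q) (x.inChart p q)) (y.inChart p q))
        (z.inChart p q) := by
    filter_upwards [inChart_interior_eventuallyEq x Ω hp,
      inChart_interior_eventuallyEq y (x.interior Ω) hp] with q h₁ h₂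
    rw [h₂, h₁]
  rw [e.extDeriv_eq, extDeriv_curryLeft_curryLeft_curryLeft (hΩ.differentiableAt_inChart hp)
    (differentiableAt_inChart x hp) (differentiableAt_inChart y hp)
    (differentiableAt_inChart z hp)
    (by rw [← inChart_extDeriv hΩ hp, h]; rfl)
    (by rw [← inChart_extDeriv_interior x hΩ hp, hx]; rfl)
    (by rw [← inChart_extDeriv_interior y hΩ hp, hy]; rfl)
    (by rw [← inChart_extDeriv_interior z hΩ hp, hz]; rfl)]
  simp only [← inChart_bracket _ _ hp, ← inChart_interior _ _ hp]
  rfl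

end TwoPlectic
end

/-! ### Twisting a hemistrict Lie 2-algebra into a semistrict one -/

namespace Lie2Algebra

variable {K : Type*} [Field K] {L₀ L₁ : Type*}
  [AddCommGroup L₀] [Module K L₀] [AddCommGroup L₁] [Module K L₁]

/-- Bilinear maps `s`, `Φ` such that the bracket `s + d Φ` on `L₀` makes `d` into a hemistrict
Lie 2-algebra with alternator `-(Φ x y + Φ y x)`. -/
structure IsContraction (d : L₁ →ₗ[K] L₀) (s : L₀ →ₗ[K] L₀ →ₗ[K] L₀)
    (Φ : L₀ →ₗ[K] L₀ →ₗ[K] L₁) : Prop where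
  contract_d_left : ∀ g y, Φ (d g) y = 0
  skew_d_left : ∀ g y, s (d g) y = 0
  skew_swap : ∀ x y, s y x = -s x y
  contract_d_contract : ∀ x y z, Φ x (d (Φ y z))
    = Φ (s x y + d (Φ x y)) z + Φ y (s x z + d (Φ x z))
  contract_skew_swap : ∀ x y z, Φ y (s x z) = -Φ x (s y z)
  jacobi : ∀ x y z, s x (s y z) + d (Φ x (s y z)) = s (s x y) z + s y (s x z)

/-- A bilinear map along which a hemistrict Lie 2-algebra with vanishing bracket on
`L₁ ⊗ L₀` can be twisted into a semistrict one. -/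
structure IsSkewing (L : Lie2Algebra K L₀ L₁) (Φ : L₀ →ₗ[K] L₀ →ₗ[K] L₁) : Prop where
  hemistrict : L.IsHemistrict
  br10 : ∀ f y, L.br10 f y = 0
  right_d : ∀ x g, Φ x (L.d g) = L.br01 x g
  left_d : ∀ g y, Φ (L.d g) y = 0
  alternator : ∀ x y, L.S x y = -(Φ x y + Φ y x)

/-- The Leibniz coboundary of `Φ` with values in the trivial representation. -/
def coboundary (L : Lie2Algebra K L₀ L₁) (Φ : L₀ →ₗ[K] L₀ →ₗ[K] L₁) :
    L₀ →ₗ[K] L₀ →ₗ[K] L₀ →ₗ[K] L₁ :=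
  LinearMap.mk₂ K (fun x y => Φ x ∘ₗ L.br00 y - Φ (L.br00 x y) - Φ y ∘ₗ L.br00 x)
    (fun x x' y => by ext z; simp; abel)
    (fun c x y => by ext z; simp [smul_sub])
    (fun x y y' => by ext z; simp; abel)
    (fun c x y => by ext z; simp [smul_sub])

@[simp]
lemma coboundary_apply (L : Lie2Algebra K L₀ L₁) (Φ : L₀ →ₗ[K] L₀ →ₗ[K] L₁) (x y z : L₀) :
    L.coboundary Φ x y z = Φ x (L.br00 y z) - Φ (L.br00 x y) z - Φ y (L.br00 x z) := rfl

variable {L : Lie2Algebra K L₀ L₁} {Φ : L₀ →ₗ[K] L₀ →ₗ[K] L₁}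

namespace IsSkewing

lemma leibniz (h : L.IsSkewing Φ) (x y z : L₀) :
    L.br00 x (L.br00 y z) = L.br00 (L.br00 x y) z + L.br00 y (L.br00 x z) := by
  simpa [h.hemistrict x y z] using L.J000 x y z

lemma br00_d (h : L.IsSkewing Φ) (x : L₀) (g : L₁) : L.br00 x (L.d g) = L.d (Φ x (L.d g)) := by
  rw [h.right_d, L.d_br01]

lemma br00_d_left (h : L.IsSkewing Φ) (g : L₁) (x : L₀) : L.br00 (L.d g) x = 0 := by
  rw [← L.d_br10, h.br10, map_zero]

/-- In the first slot every term dies because `Φ` and the bracket kill exact left arguments;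
antisymmetry moves this to the other slots. -/
lemma coboundary_d (h : L.IsSkewing Φ)
    (h₁ : ∀ x y z, L.coboundary Φ y x z = -L.coboundary Φ x y z)
    (h₂ : ∀ x y z, L.coboundary Φ x z y = -L.coboundary Φ x y z) (x y : L₀) (g : L₁) :
    L.coboundary Φ x y (L.d g) = 0 ∧ L.coboundary Φ x (L.d g) y = 0
      ∧ L.coboundary Φ (L.d g) x y = 0 := by
  have e : L.coboundary Φ (L.d g) x y = 0 := by
    simp [h.left_d, h.br00_d_left]
  have e' : L.coboundary Φ x (L.d g) y = 0 := by rw [h₁, e, neg_zero]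
  exact ⟨by rw [h₂, e', neg_zero], e', e⟩

/-- The semistrict Lie 2-algebra obtained by twisting `L` along `Φ`. -/
def twist (h : L.IsSkewing Φ)
    (h₁ : ∀ x y z, L.coboundary Φ y x z = -L.coboundary Φ x y z)
    (h₂ : ∀ x y z, L.coboundary Φ x z y = -L.coboundary Φ x y z) : Lie2Algebra K L₀ L₁ where
  d := L.d
  br00 := L.br00 - Φ.compr₂ L.d
  br01 := 0
  br10 := 0
  S := 0
  J := L.coboundary Φ
  d_br01 x g := by simp [h.br00_d x g]
  d_br10 f y := by simp [h.br00_d_left, h.left_d]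
  br_d_d f g := rfl
  S00 x y := by
    -- The symmetric part of the old bracket is `d` of the symmetrization of `Φ`, exactly what
    -- subtracting `d Φ` removes.
    have := L.S00 x y
    rw [h.alternator, map_neg, map_add] at this
    simp only [LinearMap.sub_apply, LinearMap.compr₂_apply, LinearMap.zero_apply, map_zero]
    linear_combination (norm := module) this
  S01 := by simp
  S10 := by simp
  J000 x y z := by
    simp only [LinearMap.sub_apply, LinearMap.compr₂_apply, map_sub, h.left_d, h.br00_d_left,
      coboundary_apply, h.br00_d, map_zero]
    linear_combination (norm := module) h.leibniz x y z
  J001 x y g := by simpa using (h.coboundary_d h₁ h₂ x y g).1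
  J010 x g z := by simpa using (h.coboundary_d h₁ h₂ x z g).2.1
  J100 g y z := by simpa using (h.coboundary_d h₁ h₂ y z g).2.2
  J_swap_left := h₁
  J_swap_right := h₂
  coh_JJ w x y z := by
    -- The `d Φ` corrections inside the brackets are exact, so the Jacobiator ignores them. What is
    -- left says that the coboundary of a coboundary vanishes: the Leibniz identity applied in the
    -- arguments of `Φ`.
    have c₁ a b g := (h.coboundary_d h₁ h₂ a b g).1
    have c₂ a b g := (h.coboundary_d h₁ h₂ a b g).2.1
    have c₃ a b g := (h.coboundary_d h₁ h₂ a b g).2.2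
    simp only [LinearMap.sub_apply, LinearMap.compr₂_apply, map_sub, c₁, c₂, c₃,
      LinearMap.zero_apply, sub_zero, zero_add, add_zero]
    simp only [coboundary_apply]
    have e₁ := congrArg (Φ w) (h.leibniz x y z)
    have e₂ := congrArg (Φ x) (h.leibniz w y z)
    have e₃ := congrArg (Φ y) (h.leibniz w x z)
    have e₄ := congrArg (fun t => Φ t z) (h.leibniz w x y)
    simp only [map_add, LinearMap.add_apply] at e₁ e₂ e₃ e₄
    linear_combination (norm := module) -e₁ + e₂ - e₃ - e₄
  coh_SJ_left x y z := by simpa using h₁ x y z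
  coh_SJ_right x y z := by
    rw [h₂]; simp
  coh_SS := by simp

variable (h : L.IsSkewing Φ)
    (h₁ : ∀ x y z, L.coboundary Φ y x z = -L.coboundary Φ x y z)
    (h₂ : ∀ x y z, L.coboundary Φ x z y = -L.coboundary Φ x y z)

/-- The homomorphism onto the twist, with homotopy `Φ`. -/
def toTwist : Hom L (h.twist h₁ h₂) where
  f₀ := LinearMap.id
  f₁ := LinearMap.id
  Φ := Φ
  comm g := rfl
  Φ00 x y := by simp [twist]
  Φ01 x g := by simp [twist, h.right_d]
  Φ10 g y := by simp [twist, h.left_d, h.br10]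
  coh_S x y := by simp [twist, h.alternator]
  coh_J x y z := by
    simp only [twist, LinearMap.id_apply, LinearMap.zero_apply, h.hemistrict x y z,
      coboundary_apply]
    abel

/-- The homomorphism from the twist, with homotopy `-Φ`. -/
def ofTwist : Hom (h.twist h₁ h₂) L where
  f₀ := LinearMap.id
  f₁ := LinearMap.id
  Φ := -Φ
  comm g := rfl
  Φ00 x y := by simp [twist, sub_eq_add_neg]
  Φ01 x g := by simp [twist, h.right_d]
  Φ10 g y := by simp [twist, h.left_d, h.br10]
  coh_S x y := by simp [twist, h.alternator]
  coh_J x y z := by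
    simp only [twist, LinearMap.id_apply, h.hemistrict x y z, coboundary_apply,
      LinearMap.neg_apply, LinearMap.sub_apply, LinearMap.compr₂_apply, map_sub, h.left_d,
      h.right_d, h.br10, map_neg]
    abel

lemma ofTwist_comp_toTwist : (h.ofTwist h₁ h₂).comp (h.toTwist h₁ h₂) = Hom.id L := by
  ext <;> simp [Hom.comp, Hom.id, ofTwist, toTwist]

lemma toTwist_comp_ofTwist :
    (h.toTwist h₁ h₂).comp (h.ofTwist h₁ h₂) = Hom.id (h.twist h₁ h₂) := by
  ext <;> simp [Hom.comp, Hom.id, ofTwist, toTwist]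

end IsSkewing

namespace IsContraction

variable {d : L₁ →ₗ[K] L₀} {s : L₀ →ₗ[K] L₀ →ₗ[K] L₀} {Φ : L₀ →ₗ[K] L₀ →ₗ[K] L₁}

lemma skew_d_right (h : IsContraction d s Φ) (x : L₀) (g : L₁) : s x (d g) = 0 := by
  rw [h.skew_swap, h.skew_d_left, neg_zero]

/-- The hemistrict Lie 2-algebra with bracket `s + d Φ`. -/
def toHemistrict (h : IsContraction d s Φ) : Lie2Algebra K L₀ L₁ where
  d := d
  br00 := s + Φ.compr₂ d
  br01 := Φ.compl₂ d
  br10 := 0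
  S := -(Φ + Φ.flip)
  J := 0
  d_br01 x g := by simp [h.skew_d_right]
  d_br10 f y := by simp [h.skew_d_left, h.contract_d_left]
  br_d_d f g := by simp [h.contract_d_left]
  S00 x y := by
    simp only [LinearMap.add_apply, LinearMap.compr₂_apply, LinearMap.neg_apply,
      LinearMap.flip_apply, map_neg, map_add, h.skew_swap x y]
    abel
  S01 x g := by simp [h.contract_d_left]
  S10 f y := by simp [h.contract_d_left]
  J000 x y z := by
    have e := h.jacobi x y z
    -- The Leibniz identity for `s + d Φ` splits into `jacobi` and the image under `d` of
    -- `contract_d_contract`.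
    have e' := congrArg d (h.contract_d_contract x y z)
    simp only [map_add, LinearMap.add_apply, h.contract_d_left, map_zero] at e e'
    simp only [map_add, LinearMap.add_apply, LinearMap.compr₂_apply, h.contract_d_left,
      h.skew_d_left, h.skew_d_right, LinearMap.zero_apply, map_zero]
    linear_combination (norm := module) e + e'
  J001 x y g := by
    simpa [h.skew_d_right] using h.contract_d_contract x y (d g)
  J010 := by simp
  J100 := by simp
  J_swap_left := by simp
  J_swap_right := by simp
  coh_JJ := by simp
  coh_SJ_left := by simp
  coh_SJ_right x y z := by
    -- The alternator is a symmetrization, so the identity is used in both orders of `y` and `z`.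
    have e := h.contract_d_contract x y z
    have e' := h.contract_d_contract x z y
    simp only [map_add, LinearMap.add_apply, h.contract_d_left] at e e'
    simp only [map_add, map_neg, LinearMap.add_apply, LinearMap.neg_apply, LinearMap.flip_apply,
      LinearMap.compl₂_apply, LinearMap.compr₂_apply, LinearMap.zero_apply, h.contract_d_left]
    linear_combination (norm := module) -e - e'
  coh_SS x y z := by
    simp only [LinearMap.add_apply, LinearMap.neg_apply, LinearMap.flip_apply]
    abel

lemma isSkewing (h : IsContraction d s Φ) : h.toHemistrict.IsSkewing Φ where
  hemistrict _ _ _ := rfl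
  br10 _ _ := rfl
  right_d _ _ := rfl
  left_d := h.contract_d_left
  alternator _ _ := rfl

/-- Expanding the bracket as `s + d Φ`, the derivation identity `contract_d_contract` cancels all
but one term. -/
lemma coboundary_eq (h : IsContraction d s Φ) (x y z : L₀) :
    h.toHemistrict.coboundary Φ x y z = Φ x (s y z) := by
  have e := h.contract_d_contract x y z
  simp only [coboundary_apply, toHemistrict, LinearMap.add_apply, LinearMap.compr₂_apply, map_add]
    at e ⊢
  rw [e]
  abel

lemma coboundary_swap_left (h : IsContraction d s Φ) (x y z : L₀) :
    h.toHemistrict.coboundary Φ y x z = -h.toHemistrict.coboundary Φ x y z := by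
  rw [h.coboundary_eq, h.coboundary_eq, h.contract_skew_swap]

lemma coboundary_swap_right (h : IsContraction d s Φ) (x y z : L₀) :
    h.toHemistrict.coboundary Φ x z y = -h.toHemistrict.coboundary Φ x y z := by
  rw [h.coboundary_eq, h.coboundary_eq, h.skew_swap, map_neg]

end IsContraction

end Lie2Algebra

/-! ### Hamiltonian forms as contraction data -/

noncomputable section

namespace TwoPlectic

variable {E : Type*} [NormedAddCommGroup E] [NormedSpace ℝ E]
  {X : Type*} [TopologicalSpace X] [ChartedSpace E X] [IsManifold 𝓘(ℝ, E) ∞ X]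
  {Ω : Form E X 3}

/-! ### Hamiltonian vector fields -/

lemma extDeriv_eq_hamVF (F : Ham Ω) : (F : Form E X 1).extDeriv = -(hamVF F).interior Ω :=
  F.2.2.choose_spec

/-- The contraction is `-dF`, so `d² = 0` applies. -/
lemma extDeriv_interior_hamVF (F : Ham Ω) :
    ((hamVF F).interior Ω).extDeriv = 0 := by
  have h := extDeriv_extDeriv F.2.1
  rw [extDeriv_eq_hamVF, ← neg_one_smul ℝ ((hamVF F).interior Ω), extDeriv_smul] at h
  exact (smul_eq_zero.1 h).resolve_left (by norm_num)

namespace IsTwoPlectic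

/-- Nondegeneracy makes contraction into `Ω` injective. Hence the chosen field is linear in `F` and
can be identified by exhibiting any Hamiltonian field. -/
lemma hamVF_eq (hΩ : IsTwoPlectic Ω) {F : Ham Ω} {v : VField E X}
    (hv : IsHamiltonianVF Ω (F : Form E X 1) v) : hamVF F = v := by
  have h : (hamVF F).interior Ω = v.interior Ω := by
    rw [← neg_inj, ← extDeriv_eq_hamVF, hv]
  ext x
  refine sub_eq_zero.1 (hΩ.nondegenerate x _ ?_)
  refine Eq.trans (map_sub (ContinuousAlternatingMap.curryLeft (E := E) (Ω x)) _ _) ?_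
  exact sub_eq_zero.2 (congrFun h x)

lemma hamVF_add (hΩ : IsTwoPlectic Ω) (F G : Ham Ω) : hamVF (F + G) = hamVF F + hamVF G := by
  refine hΩ.hamVF_eq ?_
  change ((F : Form E X 1) + G).extDeriv = _
  rw [extDeriv_add F.2.1 G.2.1, extDeriv_eq_hamVF, extDeriv_eq_hamVF, add_interior, neg_add]

lemma hamVF_smul (hΩ : IsTwoPlectic Ω) (c : ℝ) (F : Ham Ω) : hamVF (c • F) = c • hamVF F := by
  refine hΩ.hamVF_eq ?_
  change (c • (F : Form E X 1)).extDeriv = _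
  rw [extDeriv_smul, extDeriv_eq_hamVF, smul_interior, smul_neg]

end IsTwoPlectic

/-! ### The differential, the skew bracket and the contraction -/

omit [IsManifold 𝓘(ℝ, E) ∞ X] in
-- Reduces identities between functions to 0-forms, where the contraction lemmas apply.
lemma ofFun_injective : Function.Injective fun f : SmoothFun E X => ofFun E (f : X → ℝ) := by
  intro f g h
  ext x
  exact congrArg (fun α : Form E X 0 => α.value x) h

omit [IsManifold 𝓘(ℝ, E) ∞ X] in
lemma ofFun_add (f g : SmoothFun E X) :
    ofFun E (f + g : SmoothFun E X) = ofFun E f + ofFun E g := by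
  funext x; exact ContinuousAlternatingMap.ext_zero (E := E) rfl

omit [IsManifold 𝓘(ℝ, E) ∞ X] in
lemma ofFun_neg (f : SmoothFun E X) : ofFun E (-f : SmoothFun E X) = -ofFun E f := by
  funext x; exact ContinuousAlternatingMap.ext_zero (E := E) rfl

lemma differential_add {f g : X → ℝ} (hf : ContMDiff 𝓘(ℝ, E) 𝓘(ℝ, ℝ) ∞ f)
    (hg : ContMDiff 𝓘(ℝ, E) 𝓘(ℝ, ℝ) ∞ g) :
    (differential (f + g) : Form E X 1) = differential f + differential g := by
  have e : ofFun E (f + g) = ofFun E f + ofFun E g := by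
    funext x; exact ContinuousAlternatingMap.ext_zero (E := E) rfl
  rw [differential_eq_extDeriv hf, differential_eq_extDeriv hg,
    ← extDeriv_add (isSmooth_ofFun hf) (isSmooth_ofFun hg), ← e,
    differential_eq_extDeriv (hf.add hg)]

lemma differential_smul (c : ℝ) {f : X → ℝ} (hf : ContMDiff 𝓘(ℝ, E) 𝓘(ℝ, ℝ) ∞ f) :
    (differential (c • f) : Form E X 1) = c • differential f := by
  have e : ofFun E (c • f) = c • ofFun E f := by
    funext x; exact ContinuousAlternatingMap.ext_zero (E := E) rfl
  have hc : ContMDiff 𝓘(ℝ, E) 𝓘(ℝ, ℝ) ∞ (c • f) := by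
    have hk : ContMDiff 𝓘(ℝ, E) 𝓘(ℝ, ℝ) ∞ (fun _ : X => c) := contMDiff_const
    exact hk.smul hf
  rw [differential_eq_extDeriv hf, ← extDeriv_smul, ← e, differential_eq_extDeriv hc]

lemma isHamiltonianVF_differential (Ω : Form E X 3) (f : SmoothFun E X) :
    IsHamiltonianVF Ω (differential f) 0 := by
  rw [IsHamiltonianVF, extDeriv_differential f.contMDiff, zero_interior, neg_zero]

/-- The differential `C^∞(X) → Ham(X)`. -/
def hamD (Ω : Form E X 3) : SmoothFun E X →ₗ[ℝ] Ham Ω where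
  toFun f := ⟨differential f, isSmooth_differential f.contMDiff, 0,
    isHamiltonianVF_differential Ω f⟩
  map_add' f g := Subtype.ext (differential_add f.contMDiff g.contMDiff)
  map_smul' c f := Subtype.ext (differential_smul c f.contMDiff)

namespace IsTwoPlectic

lemma hamVF_hamD (hΩ : IsTwoPlectic Ω) (f : SmoothFun E X) : hamVF (hamD Ω f) = 0 :=
  hΩ.hamVF_eq (isHamiltonianVF_differential Ω f)

variable [FiniteDimensional ℝ E]

lemma isHamiltonianVF_skewBracket (hΩ : IsTwoPlectic Ω) (F G : Ham Ω) :
    IsHamiltonianVF Ω ((hamVF G).interior ((hamVF F).interior Ω))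
      (bracket (hamVF F) (hamVF G)) :=
  extDeriv_interior_interior hΩ.smooth hΩ.closed (extDeriv_interior_hamVF F)
    (extDeriv_interior_hamVF G)

/-- The bracket `ι_{v_G} ι_{v_F} Ω` on Hamiltonian 1-forms. -/
def skewBracket (hΩ : IsTwoPlectic Ω) : Ham Ω →ₗ[ℝ] Ham Ω →ₗ[ℝ] Ham Ω :=
  LinearMap.mk₂ ℝ (fun F G => ⟨(hamVF G).interior ((hamVF F).interior Ω),
      isSmooth_interior _ (isSmooth_interior _ hΩ.smooth), _, hΩ.isHamiltonianVF_skewBracket F G⟩)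
    (fun F F' G => Subtype.ext (by
      simp [hΩ.hamVF_add, add_interior, interior_add]))
    (fun c F G => Subtype.ext (by
      simp [hΩ.hamVF_smul, smul_interior, interior_smul]))
    (fun F G G' => Subtype.ext (by simp [hΩ.hamVF_add, add_interior]))
    (fun c F G => Subtype.ext (by simp [hΩ.hamVF_smul, smul_interior]))

lemma coe_skewBracket (hΩ : IsTwoPlectic Ω) (F G : Ham Ω) :
    (hΩ.skewBracket F G : Form E X 1) = (hamVF G).interior ((hamVF F).interior Ω) := rfl

lemma hamVF_skewBracket (hΩ : IsTwoPlectic Ω) (F G : Ham Ω) :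
    hamVF (hΩ.skewBracket F G) = bracket (hamVF F) (hamVF G) :=
  hΩ.hamVF_eq (hΩ.isHamiltonianVF_skewBracket F G)

/-- The contraction `ι_{v_F} G` of Hamiltonian 1-forms. -/
def contraction (hΩ : IsTwoPlectic Ω) : Ham Ω →ₗ[ℝ] Ham Ω →ₗ[ℝ] SmoothFun E X :=
  LinearMap.mk₂ ℝ (fun F G => ⟨((hamVF F).interior (G : Form E X 1)).value,
      (isSmooth_interior _ G.2.1).contMDiff_value⟩)
    (fun F F' G => by
      ext x
      simp only [ContMDiffMap.coeFn_mk]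
      rw [hΩ.hamVF_add, add_interior]; rfl)
    (fun c F G => by
      ext x
      simp only [ContMDiffMap.coeFn_mk]
      rw [hΩ.hamVF_smul, smul_interior]; rfl)
    (fun F G G' => rfl)
    (fun c F G => rfl)

lemma coe_contraction (hΩ : IsTwoPlectic Ω) (F G : Ham Ω) :
    (hΩ.contraction F G : X → ℝ) = ((hamVF F).interior (G : Form E X 1)).value := rfl

lemma ofFun_contraction (hΩ : IsTwoPlectic Ω) (F G : Ham Ω) :
    ofFun E (hΩ.contraction F G) = (hamVF F).interior (G : Form E X 1) :=
  ofFun_value ((hamVF F).interior (G : Form E X 1))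

lemma coe_hamD_contraction (hΩ : IsTwoPlectic Ω) (F G : Ham Ω) :
    (hamD Ω (hΩ.contraction F G) : Form E X 1)
      = ((hamVF F).interior (G : Form E X 1)).extDeriv :=
  (isSmooth_interior _ G.2.1).extDeriv_eq_differential.symm

lemma isContraction (hΩ : IsTwoPlectic Ω) :
    Lie2Algebra.IsContraction (K := ℝ) (L₀ := Ham Ω) (L₁ := SmoothFun E X) (hamD Ω)
      hΩ.skewBracket hΩ.contraction where
  contract_d_left g y := by
    refine ofFun_injective ?_
    simp only
    rw [ofFun_contraction, hΩ.hamVF_hamD, zero_interior]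
    funext x; exact ContinuousAlternatingMap.ext_zero (E := E) rfl
  skew_d_left g y := by
    refine Subtype.ext ?_
    rw [coe_skewBracket, hΩ.hamVF_hamD, zero_interior, interior_zero]
    rfl
  skew_swap x y := by
    refine Subtype.ext ?_
    rw [Submodule.coe_neg, coe_skewBracket, coe_skewBracket, interior_interior_swap]
  contract_d_contract x y z := by
    refine ofFun_injective ?_
    simp only
    rw [ofFun_add, ofFun_contraction, ofFun_contraction, ofFun_contraction, hΩ.hamVF_add,
      hΩ.hamVF_hamD, add_zero, hΩ.hamVF_skewBracket, Submodule.coe_add, interior_add,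
      coe_hamD_contraction, coe_hamD_contraction, coe_skewBracket]
    -- Substituting `dz = -ι_{v_z} Ω` turns the left side into the contraction of `s x z` with
    -- `v_y`.
    have h := interior_interior_extDeriv (hamVF x) (hamVF y) z.2.1
    rw [extDeriv_eq_hamVF, interior_neg, interior_interior_swap (hamVF x) (hamVF z), neg_neg] at h
    rw [h]
    abel
  contract_skew_swap x y z := by
    refine ofFun_injective ?_
    simp only
    rw [ofFun_neg, ofFun_contraction, ofFun_contraction, coe_skewBracket, coe_skewBracket]
    rw [interior_interior_swap (hamVF z) (hamVF x) Ω, interior_neg,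
      interior_interior_swap (hamVF z) (hamVF y) Ω, interior_neg,
      interior_interior_swap (hamVF y) (hamVF x)]
  jacobi x y z := by
    refine Subtype.ext ?_
    rw [Submodule.coe_add, Submodule.coe_add, coe_hamD_contraction]
    simp only [coe_skewBracket, hΩ.hamVF_skewBracket]
    have h := extDeriv_interior_interior_interior hΩ.smooth hΩ.closed
      (extDeriv_interior_hamVF x) (extDeriv_interior_hamVF y) (extDeriv_interior_hamVF z)
    -- Two transpositions bring the triple contraction to the order of `h` with no net sign.
    rw [interior_interior_swap (hamVF x) (hamVF z), interior_interior_swap (hamVF x) (hamVF y) Ω,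
      interior_neg, neg_neg, h]
    abel

end IsTwoPlectic

end TwoPlectic

end

open TwoPlectic in
theorem theorem4p6 {E : Type*} [NormedAddCommGroup E] [NormedSpace ℝ E] [FiniteDimensional ℝ E]
    {X : Type*} [TopologicalSpace X] [T2Space X] [ChartedSpace E X] [IsManifold 𝓘(ℝ, E) ∞ X]
    (Ω : Form E X 3) (hΩ : IsTwoPlectic Ω) :
    ∃ Lh Ls : Lie2Algebra ℝ (Ham Ω) (SmoothFun E X),
      IsHemistrictLie2 Ω Lh ∧ IsSemistrictLie2 Ω Ls ∧
      ∃ (φ : Lie2Algebra.Hom Lh Ls) (ψ : Lie2Algebra.Hom Ls Lh),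
        φ.f₀ = LinearMap.id ∧ φ.f₁ = LinearMap.id ∧
        (∀ (F G : Ham Ω) (x : X),
          φ.Φ F G x = ((hamVF F).interior (G : Form E X 1)).value x) ∧
        ψ.f₀ = LinearMap.id ∧ ψ.f₁ = LinearMap.id ∧
        ψ.comp φ = Lie2Algebra.Hom.id Lh ∧
        φ.comp ψ = Lie2Algebra.Hom.id Ls := by
  have h := hΩ.isContraction
  refine ⟨h.toHemistrict, h.isSkewing.twist h.coboundary_swap_left h.coboundary_swap_right,
    ?_, ?_, h.isSkewing.toTwist h.coboundary_swap_left h.coboundary_swap_right,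
    h.isSkewing.ofTwist h.coboundary_swap_left h.coboundary_swap_right, rfl, rfl,
    fun _ _ _ => rfl, rfl, rfl, h.isSkewing.ofTwist_comp_toTwist _ _,
    h.isSkewing.toTwist_comp_ofTwist _ _⟩
  · refine ⟨fun _ => rfl, fun F G => ?_, fun F f x => rfl, fun _ _ => rfl, fun F G x => rfl,
      fun _ _ _ => rfl⟩
    change (hΩ.skewBracket F G : Form E X 1) + (hamD Ω (hΩ.contraction F G) : Form E X 1) = _
    -- Cartan's formula: after `dG = -ι_{v_G} Ω` and one swap, its first term is the skew bracket.
    rw [lieDeriv_eq _ G.2.1, hΩ.coe_hamD_contraction, hΩ.coe_skewBracket, extDeriv_eq_hamVF,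
      interior_neg, interior_interior_swap]
  · refine ⟨fun _ => rfl, fun F G => ?_, fun _ _ => rfl, fun _ _ => rfl, fun _ _ => rfl,
      fun F G H x => ?_⟩
    · change ((hΩ.skewBracket F G + hamD Ω (hΩ.contraction F G)
        - hamD Ω (hΩ.contraction F G) : Ham Ω) : Form E X 1) = _
      exact congrArg Subtype.val (add_sub_cancel_right (hΩ.skewBracket F G)
        (hamD Ω (hΩ.contraction F G)))
    · change h.toHemistrict.coboundary hΩ.contraction F G H x = _
      -- The minus sign of the Jacobiator comes from reordering `v_H` and `v_G`.
      rw [h.coboundary_eq, hΩ.coe_contraction, hΩ.coe_skewBracket, interior_interior_swap (hamVF H),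
        interior_neg]
      rfl
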